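/- Let $\mathbb N=\{1,2,\dots\}$. For a family $\mathcal F$ of finite subsets of $\mathbb N$ call finite non-empty sets $E_1<E_2<\dots<E_d$ (meaning $\max E_i<\min E_{i+1}$) $\mathcal F$-admissible if $\{\min E_1,\dots,\min E_d\}\in\mathcal F$. For each countable limit ordinal $\zeta$ fix ordinals $\zeta_1<\zeta_2<\cdots$ with supremum $\zeta$. The Schreier families $\mathcal S_\xi$, $\xi<\omega_1$, are defined by $\mathcal S_0=\{\varnothing\}\cup\{\{n\}:n\in\mathbb N\}$, $\mathcal S_1=\{F:\#F\le\min F\}\cup\{\varnothing\}$, $$\mathcal S_{\xi+1}=\Bigl\{\bigcup_{i=1}^dG_i : G_1<\dots<G_d \text{ are in } \mathcal S_\xi \text{ and are } \mathcal S_1\text{-admissible}\Bigr\},$$ and $\mathcal S_\zeta=\{F: \exists n\in\mathbb N,\ n\le\min F \text{ and } F\in\mathcal S_{\zeta_n}\}$ (with the condition $n\le \min F$ void for $F=\varnothing$) if $\zeta$ is a limit. Let $T[\mathcal F,\frac12]$ be the completion of the space $c_{00}$ of finitely supported real sequences under the unique norm with $$\|x\|=\max\Bigl\{\|x\|_\infty,\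 \sup\tfrac12\sum_{i=1}^d\|E_ix\|\Bigr\},$$ the supremum being over all $\mathcal F$-admissible $E_1<\dots<E_d$, where $E_ix$ is the restriction of $x$ to $E_i$. For Banach spaces $X,Y$ and $1\le\xi<\omega_1$ let $\mathcal{SS}_\xi(X,Y)$ be the set of bounded operators $T:X\to Y$ such that for every $\varepsilon>0$ and every basic sequence $(x_n)_{n\ge1}$ in $X$ there are $F\in\mathcal S_\xi$ and $0\neq z\in\operatorname{span}\{x_i:i\in F\}$ with $\|Tz\|\le\varepsilon\|z\|$; write $\mathcal{SS}_\xi(X)=\mathcal{SS}_\xi(X,X)$. Let $1\le\xi<\omega_1$, $X=T[\mathcal S_{\xi\omega},\frac12]$ and $Y=T[\mathcal S_\xi,\frac12]$. Then: 1. The identity of $c_{00}$ extends to a bounded injective operator $i_\xi:X\to Y$ (the formal inclusion), and $i_\xi\in\mathcal{SS}_{\xi\omega}(X,Y)$ but $i_\xi\notin\mathcal{SS}_\xi(X,Y)$. 2. Consequently the classes can increase strictly: $\mathcal{SS}_\xi(X,Y)\subsetneq\mathcal{SS}_{\xi\omega}(X,Y)$, and, for the single space $Z=X\oplus Y$ (with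 the maximum norm), $\mathcal{SS}_\xi(Z)\subsetneq\mathcal{SS}_{\xi\omega}(Z)$. -/

import Mathlib

open Order Filter Topology
open scoped Ordinal

noncomputable section

/-! ### Schreier families

Finite sets of positive integers are modelled by `Finset ℕ+`. -/

/-- The sets `E 0 < E 1 < ⋯ < E (d - 1)` are finite, non-empty and successive, and the set of
their minima belongs to the family `F`. -/
def IsAdmissible (F : Set (Finset ℕ+)) {d : ℕ} (E : Fin d → Finset ℕ+) : Prop :=
  (∀ i j, i < j → ∀ a ∈ E i, ∀ b ∈ E j, a < b) ∧
    ∃ m : Fin d → ℕ+, (∀ i, IsLeast (E i : Set ℕ+) (m i)) ∧ Finset.univ.image m ∈ F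

/-- The family `F[G]` of all unions `G 1 ∪ ⋯ ∪ G n` with `G 1 < ⋯ < G n` non-empty members of `G`
whose set of minima belongs to `F`. -/
def familyComp (F G : Set (Finset ℕ+)) : Set (Finset ℕ+) :=
  {A | ∃ (d : ℕ) (E : Fin d → Finset ℕ+), (∀ i, E i ∈ G) ∧ IsAdmissible F E ∧
    A = Finset.univ.biUnion E}

/-- The empty set and the singletons. -/
def schreierZero : Set (Finset ℕ+) := {A | A.card ≤ 1}

/-- The sets `A` with `#A ≤ min A`, together with the empty set. -/
def schreierOne : Set (Finset ℕ+) := {A | ∀ n ∈ A, A.card ≤ (n : ℕ)}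

/-- For every countable limit ordinal `ζ`, the sequence `ladder ζ` increases strictly to `ζ`. -/
def IsLadderSystem (ladder : Ordinal.{0} → ℕ+ → Ordinal.{0}) : Prop :=
  ∀ ζ, IsSuccLimit ζ → ζ < ω₁ → StrictMono (ladder ζ) ∧ IsLUB (Set.range (ladder ζ)) ζ

open Classical in
/-- The Schreier families, for a given choice of sequences increasing to the limit ordinals.
(At a limit ordinal the guard `ladder ζ n < ζ` holds for every ladder system if `ζ < ω₁`.) -/
def schreier (ladder : Ordinal.{0} → ℕ+ → Ordinal.{0}) (ξ : Ordinal.{0}) : Set (Finset ℕ+) :=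
  Ordinal.limitRecOn ξ schreierZero (fun _ S => familyComp schreierOne S)
    (fun ζ _ S => {A | ∃ (n : ℕ+) (h : ladder ζ n < ζ), A ∈ S (ladder ζ n) h ∧ ∀ k ∈ A, n ≤ k})

theorem schreier_zero (ladder : Ordinal.{0} → ℕ+ → Ordinal.{0}) :
    schreier ladder 0 = schreierZero := by
  simp [schreier]

theorem schreier_succ (ladder : Ordinal.{0} → ℕ+ → Ordinal.{0}) (ξ : Ordinal.{0}) :
    schreier ladder (ξ + 1) = familyComp schreierOne (schreier ladder ξ) := by
  simp [schreier]

theorem schreier_limit {ladder : Ordinal.{0} → ℕ+ → Ordinal.{0}} (hl : IsLadderSystem ladder)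
    {ζ : Ordinal.{0}} (hζ : IsSuccLimit ζ) (hζ' : ζ < ω₁) :
    schreier ladder ζ = {A | ∃ n : ℕ+, (∀ k ∈ A, n ≤ k) ∧ A ∈ schreier ladder (ladder ζ n)} := by
  have key : ∀ n, ladder ζ n < ζ := fun n =>
    lt_of_lt_of_le ((hl ζ hζ hζ').1 (PNat.lt_add_right n 1)) ((hl ζ hζ hζ').2.1 ⟨n + 1, rfl⟩)
  ext A
  rw [schreier, Ordinal.limitRecOn_limit _ _ _ _ hζ]
  constructor
  · rintro ⟨n, _, h1, h2⟩
    exact ⟨n, h2, h1⟩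
  · rintro ⟨n, h2, h1⟩
    exact ⟨n, key n, h1, h2⟩

theorem schreier_one (ladder : Ordinal.{0} → ℕ+ → Ordinal.{0}) :
    schreier ladder 1 = schreierOne := by
  rw [← zero_add (1 : Ordinal.{0}), schreier_succ, schreier_zero]
  ext A
  constructor
  · rintro ⟨d, E, hE, ⟨-, m, hm, hmF⟩, rfl⟩
    have : Finset.univ.biUnion E = Finset.univ.image m := by
      ext a
      simp only [Finset.mem_biUnion, Finset.mem_univ, true_and, Finset.mem_image]
      refine exists_congr fun i => ⟨fun h => ?_, fun h => h ▸ (hm i).1⟩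
      exact Finset.card_le_one.1 (hE i) _ (hm i).1 _ h
    rw [this]; exact hmF
  · intro hA
    refine ⟨A.card, fun i => {A.orderEmbOfFin rfl i}, fun i => by simp [schreierZero],
      ⟨?_, A.orderEmbOfFin rfl, fun i => by simp, ?_⟩, ?_⟩
    · intro i j hij a ha b hb
      rw [Finset.mem_singleton] at ha hb
      subst ha hb
      exact (A.orderEmbOfFin rfl).strictMono hij
    · rwa [Finset.image_orderEmbOfFin_univ]
    · ext a
      have : A = Finset.univ.image (A.orderEmbOfFin rfl) := by
        rw [Finset.image_orderEmbOfFin_univ]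
      conv_lhs => rw [this]
      simp only [Finset.mem_image, Finset.mem_univ, true_and, Finset.mem_biUnion,
        Finset.mem_singleton]
      exact exists_congr fun i => eq_comm

/-! ### The Tsirelson type spaces `T[F, 1/2]` -/

/-- The projection `x ↦ E x` of `c₀₀` onto the coordinates in `E`. -/
def coordRestrict (E : Finset ℕ+) : (ℕ+ →₀ ℝ) →ₗ[ℝ] (ℕ+ →₀ ℝ) where
  toFun x := x.filter (· ∈ E)
  map_add' _ _ := Finsupp.filter_add
  map_smul' _ _ := Finsupp.filter_smul

/-- The norming functionals of `T[F, 1/2]`: the smallest set of functionals on `c₀₀` that contains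
`± eₙ*` and is closed under `(fᵢ) ↦ (1/2) ∑ᵢ fᵢ ∘ Eᵢ` for `F`-admissible `E₁ < ⋯ < E_d`. -/
inductive IsNorming (F : Set (Finset ℕ+)) : ((ℕ+ →₀ ℝ) →ₗ[ℝ] ℝ) → Prop
  | pos (n : ℕ+) : IsNorming F (Finsupp.lapply n)
  | neg (n : ℕ+) : IsNorming F (-Finsupp.lapply n)
  | half {d : ℕ} (E : Fin d → Finset ℕ+) (f : Fin d → ((ℕ+ →₀ ℝ) →ₗ[ℝ] ℝ)) :
      IsAdmissible F E → (∀ i, IsNorming F (f i)) →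
        IsNorming F ((1 / 2 : ℝ) • ∑ i, (f i) ∘ₗ coordRestrict (E i))

/-- The norm of `T[F, 1/2]` on `c₀₀`; by `tsirelsonNorm_isLUB` and `tsirelsonNorm_unique` it is
the unique solution of the implicit equation
`‖x‖ = max (‖x‖_∞) (sup (1/2) ∑ᵢ ‖Eᵢ x‖)`, the supremum over all `F`-admissible `E₁ < ⋯ < E_d`. -/
def tsirelsonNorm (F : Set (Finset ℕ+)) (x : ℕ+ →₀ ℝ) : ℝ :=
  ⨆ f : {f : (ℕ+ →₀ ℝ) →ₗ[ℝ] ℝ // IsNorming F f}, f.1 x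

theorem IsAdmissible.sum_le {F : Set (Finset ℕ+)} {d : ℕ} {E : Fin d → Finset ℕ+}
    (hE : IsAdmissible F E) (x : ℕ+ →₀ ℝ) :
    ∑ i, (∑ n ∈ (coordRestrict (E i) x).support, |coordRestrict (E i) x n|) ≤
      ∑ n ∈ x.support, |x n| := by
  have h1 : ∀ i, ∑ n ∈ (coordRestrict (E i) x).support, |coordRestrict (E i) x n| =
      ∑ n ∈ x.support.filter (· ∈ E i), |x n| := by
    intro i
    have : (coordRestrict (E i) x).support = x.support.filter (· ∈ E i) := by
      simp [coordRestrict]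
    rw [this]
    refine Finset.sum_congr rfl fun n hn => ?_
    simp [coordRestrict, (Finset.mem_filter.1 hn).2]
  simp_rw [h1]
  rw [← Finset.sum_biUnion]
  · refine Finset.sum_le_sum_of_subset_of_nonneg ?_ fun _ _ _ => abs_nonneg _
    intro n hn
    simp only [Finset.mem_biUnion, Finset.mem_filter] at hn
    obtain ⟨_, _, h, _⟩ := hn
    exact h
  · intro i _ j _ hij
    refine Finset.disjoint_left.2 fun a ha hb => ?_
    have ha := (Finset.mem_filter.1 ha).2
    have hb := (Finset.mem_filter.1 hb).2
    rcases lt_or_gt_of_ne hij with h | h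
    · exact lt_irrefl _ (hE.1 i j h a ha a hb)
    · exact lt_irrefl _ (hE.1 j i h a hb a ha)

theorem IsNorming.le_sum {F : Set (Finset ℕ+)} {f : (ℕ+ →₀ ℝ) →ₗ[ℝ] ℝ} (hf : IsNorming F f) :
    ∀ x : ℕ+ →₀ ℝ, f x ≤ ∑ n ∈ x.support, |x n| := by
  have h0 : ∀ (n : ℕ+) (x : ℕ+ →₀ ℝ), |x n| ≤ ∑ n ∈ x.support, |x n| := by
    intro n x
    by_cases hn : n ∈ x.support
    · exact Finset.single_le_sum (f := fun n => |x n|) (fun _ _ => abs_nonneg _) hn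
    · rw [Finsupp.notMem_support_iff.1 hn, abs_zero]
      exact Finset.sum_nonneg fun _ _ => abs_nonneg _
  induction hf with
  | pos n => exact fun x => (le_abs_self _).trans (h0 n x)
  | neg n => exact fun x => (neg_le_abs _).trans (h0 n x)
  | half E f hE _ ih =>
    intro x
    have h1 : ∑ i, f i (coordRestrict (E i) x) ≤ ∑ n ∈ x.support, |x n| :=
      (Finset.sum_le_sum fun i _ => ih i _).trans (hE.sum_le x)
    have h2 : 0 ≤ ∑ n ∈ x.support, |x n| := Finset.sum_nonneg fun _ _ => abs_nonneg _
    simp only [LinearMap.smul_apply, LinearMap.sum_apply, LinearMap.comp_apply, smul_eq_mul]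
    linarith

theorem IsNorming.le_tsirelsonNorm {F : Set (Finset ℕ+)} {f : (ℕ+ →₀ ℝ) →ₗ[ℝ] ℝ}
    (hf : IsNorming F f) (x : ℕ+ →₀ ℝ) : f x ≤ tsirelsonNorm F x :=
  le_ciSup (f := fun f : {f : (ℕ+ →₀ ℝ) →ₗ[ℝ] ℝ // IsNorming F f} => f.1 x)
    ⟨_, by rintro _ ⟨g, rfl⟩; exact g.2.le_sum x⟩ ⟨f, hf⟩

instance (F : Set (Finset ℕ+)) : Nonempty {f : (ℕ+ →₀ ℝ) →ₗ[ℝ] ℝ // IsNorming F f} :=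
  ⟨⟨_, .pos 1⟩⟩

theorem abs_le_tsirelsonNorm (F : Set (Finset ℕ+)) (x : ℕ+ →₀ ℝ) (n : ℕ+) :
    |x n| ≤ tsirelsonNorm F x :=
  abs_le'.2 ⟨(IsNorming.pos n).le_tsirelsonNorm x, (IsNorming.neg n).le_tsirelsonNorm x⟩

theorem tsirelsonNorm_nonneg (F : Set (Finset ℕ+)) (x : ℕ+ →₀ ℝ) : 0 ≤ tsirelsonNorm F x :=
  (abs_nonneg _).trans (abs_le_tsirelsonNorm F x 1)

theorem IsNorming.neg' {F : Set (Finset ℕ+)} {f : (ℕ+ →₀ ℝ) →ₗ[ℝ] ℝ} (hf : IsNorming F f) :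
    IsNorming F (-f) := by
  induction hf with
  | pos n => exact .neg n
  | neg n => rw [neg_neg]; exact .pos n
  | half E f hE _ ih =>
    have := IsNorming.half E (fun i => -f i) hE ih
    simpa [LinearMap.neg_comp, Finset.sum_neg_distrib] using this

theorem tsirelsonNorm_add_le (F : Set (Finset ℕ+)) (x y : ℕ+ →₀ ℝ) :
    tsirelsonNorm F (x + y) ≤ tsirelsonNorm F x + tsirelsonNorm F y :=
  ciSup_le fun f => by
    rw [map_add]; exact add_le_add (f.2.le_tsirelsonNorm x) (f.2.le_tsirelsonNorm y)

theorem tsirelsonNorm_smul_le (F : Set (Finset ℕ+)) (c : ℝ) (x : ℕ+ →₀ ℝ) :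
    tsirelsonNorm F (c • x) ≤ |c| * tsirelsonNorm F x :=
  ciSup_le fun f => by
    have h : |f.1 x| ≤ tsirelsonNorm F x :=
      abs_le'.2 ⟨f.2.le_tsirelsonNorm x, f.2.neg'.le_tsirelsonNorm x⟩
    rw [map_smul, smul_eq_mul]
    calc c * f.1 x ≤ |c * f.1 x| := le_abs_self _
      _ = |c| * |f.1 x| := abs_mul _ _
      _ ≤ _ := by gcongr

theorem tsirelsonNorm_smul (F : Set (Finset ℕ+)) (c : ℝ) (x : ℕ+ →₀ ℝ) :
    tsirelsonNorm F (c • x) = |c| * tsirelsonNorm F x := by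
  refine le_antisymm (tsirelsonNorm_smul_le F c x) ?_
  by_cases hc : c = 0
  · simpa [hc] using tsirelsonNorm_nonneg F 0
  · have h := tsirelsonNorm_smul_le F c⁻¹ (c • x)
    rw [inv_smul_smul₀ hc, abs_inv] at h
    have hc' : 0 < |c| := abs_pos.2 hc
    calc |c| * tsirelsonNorm F x ≤ |c| * (|c|⁻¹ * tsirelsonNorm F (c • x)) := by gcongr
      _ = _ := by field_simp

/-- The implicit equation for the norm. -/
theorem tsirelsonNorm_isLUB (F : Set (Finset ℕ+)) (x : ℕ+ →₀ ℝ) :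
    IsLUB ({r | ∃ n, r = |x n|} ∪
      {r | ∃ (d : ℕ) (E : Fin d → Finset ℕ+), IsAdmissible F E ∧
        r = 1 / 2 * ∑ i, tsirelsonNorm F (coordRestrict (E i) x)}) (tsirelsonNorm F x) := by
  constructor
  · rintro _ (⟨n, rfl⟩ | ⟨d, E, hE, rfl⟩)
    · exact abs_le_tsirelsonNorm F x n
    · refine le_of_forall_pos_le_add fun ε hε => ?_
      have hδ : 0 < ε / (d + 1) := by positivity
      have : ∀ i, ∃ f : {f : (ℕ+ →₀ ℝ) →ₗ[ℝ] ℝ // IsNorming F f},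
          tsirelsonNorm F (coordRestrict (E i) x) - ε / (d + 1) < f.1 (coordRestrict (E i) x) :=
        fun i => exists_lt_of_lt_ciSup (sub_lt_self _ hδ)
      choose f hf using this
      have h1 := (IsNorming.half E (fun i => (f i).1) hE fun i => (f i).2).le_tsirelsonNorm x
      simp only [LinearMap.smul_apply, LinearMap.sum_apply, LinearMap.comp_apply,
        smul_eq_mul] at h1
      have h2 : ∑ i, (tsirelsonNorm F (coordRestrict (E i) x) - ε / (d + 1)) ≤
          ∑ i, (f i).1 (coordRestrict (E i) x) := Finset.sum_le_sum fun i _ => (hf i).le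
      rw [Finset.sum_sub_distrib, Finset.sum_const, Finset.card_univ, Fintype.card_fin,
        nsmul_eq_mul] at h2
      have h3 : (d : ℝ) * (ε / (d + 1)) ≤ ε := by
        rw [mul_div_assoc', div_le_iff₀ (by positivity)]; nlinarith
      linarith
  · intro b hb
    refine ciSup_le fun f => ?_
    rcases f with ⟨f, hf⟩
    cases hf with
    | pos n => exact (le_abs_self _).trans (hb (Or.inl ⟨n, rfl⟩))
    | neg n => exact (neg_le_abs _).trans (hb (Or.inl ⟨n, rfl⟩))
    | half E f hE hf =>
      refine le_trans ?_ (hb (Or.inr ⟨_, E, hE, rfl⟩))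
      simp only [LinearMap.smul_apply, LinearMap.sum_apply, LinearMap.comp_apply, smul_eq_mul]
      gcongr with i
      exact (hf i).le_tsirelsonNorm _

/-- A function `N` on `c₀₀` (in particular a norm) that satisfies the implicit equation and
vanishes at `0` coincides with `tsirelsonNorm F`. -/
theorem tsirelsonNorm_unique (F : Set (Finset ℕ+)) (N : (ℕ+ →₀ ℝ) → ℝ) (hN0 : N 0 = 0)
    (hN : ∀ x, IsLUB ({r | ∃ n, r = |x n|} ∪
      {r | ∃ (d : ℕ) (E : Fin d → Finset ℕ+), IsAdmissible F E ∧
        r = 1 / 2 * ∑ i, N (coordRestrict (E i) x)}) (N x)) :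
    N = tsirelsonNorm F := by
  have hT := tsirelsonNorm_isLUB F
  have hT0 : tsirelsonNorm F 0 = 0 := by simpa using tsirelsonNorm_smul F 0 0
  generalize tsirelsonNorm F = M at hT hT0
  suffices H : ∀ P Q : (ℕ+ →₀ ℝ) → ℝ, P 0 = 0 → Q 0 = 0 →
      (∀ x, IsLUB ({r | ∃ n, r = |x n|} ∪
        {r | ∃ (d : ℕ) (E : Fin d → Finset ℕ+), IsAdmissible F E ∧
          r = 1 / 2 * ∑ i, P (coordRestrict (E i) x)}) (P x)) →
      (∀ x, IsLUB ({r | ∃ n, r = |x n|} ∪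
        {r | ∃ (d : ℕ) (E : Fin d → Finset ℕ+), IsAdmissible F E ∧
          r = 1 / 2 * ∑ i, Q (coordRestrict (E i) x)}) (Q x)) →
      ∀ k (x : ℕ+ →₀ ℝ), x.support.card = k → P x ≤ Q x from
    funext fun x => le_antisymm (H _ _ hN0 hT0 hN hT _ x rfl) (H _ _ hT0 hN0 hT hN _ x rfl)
  intro P Q hP0 hQ0 hP hQ k
  induction k using Nat.strong_induction_on with
  | _ k ih =>
  rintro x rfl
  have hQx : 0 ≤ Q x := (abs_nonneg _).trans ((hQ x).1 (Or.inl ⟨1, rfl⟩))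
  have hle : P x ≤ max (Q x) (P x / 2) := by
    refine (hP x).2 ?_
    rintro _ (⟨n, rfl⟩ | ⟨d, E, hE, rfl⟩)
    · exact le_max_of_le_left ((hQ x).1 (Or.inl ⟨n, rfl⟩))
    by_cases hc : ∃ i, x.support ⊆ E i
    · obtain ⟨i, hi⟩ := hc
      refine le_max_of_le_right (le_of_eq ?_)
      rw [Finset.sum_eq_single i]
      · have : coordRestrict (E i) x = x := by
          refine (Finsupp.filter_eq_self_iff _ _).2 fun n hn => hi (Finsupp.mem_support_iff.2 hn)
        rw [this]; ring
      · intro j _ hj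
        have : coordRestrict (E j) x = 0 := by
          refine (Finsupp.filter_eq_zero_iff _ _).2 fun n hn => ?_
          by_contra hx
          have hn' := hi (Finsupp.mem_support_iff.2 hx)
          rcases lt_or_gt_of_ne hj with h | h
          · exact lt_irrefl _ (hE.1 j i h n hn n hn')
          · exact lt_irrefl _ (hE.1 i j h n hn' n hn)
        rw [this, hP0]
      · simp
    · push Not at hc
      refine le_max_of_le_left (le_trans ?_ ((hQ x).1 (Or.inr ⟨d, E, hE, rfl⟩)))
      gcongr with i
      refine ih _ (Finset.card_lt_card ?_) _ rfl
      have : (coordRestrict (E i) x).support = x.support.filter (· ∈ E i) := by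
        simp [coordRestrict]
      rw [this]
      exact Finset.filter_ssubset.2 (Finset.not_subset.1 (hc i))
  rcases le_max_iff.1 hle with h | h
  · exact h
  · linarith

/-- The space `c₀₀` of finitely supported real sequences with the norm of `T[F, 1/2]`. -/
def TsirelsonC00 (_F : Set (Finset ℕ+)) : Type := ℕ+ →₀ ℝ

instance (F : Set (Finset ℕ+)) : AddCommGroup (TsirelsonC00 F) :=
  inferInstanceAs (AddCommGroup (ℕ+ →₀ ℝ))

instance (F : Set (Finset ℕ+)) : Module ℝ (TsirelsonC00 F) :=
  inferInstanceAs (Module ℝ (ℕ+ →₀ ℝ))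

instance (F : Set (Finset ℕ+)) : Norm (TsirelsonC00 F) := ⟨tsirelsonNorm F⟩

theorem tsirelsonC00_core (F : Set (Finset ℕ+)) : NormedSpace.Core ℝ (TsirelsonC00 F) where
  norm_nonneg x := tsirelsonNorm_nonneg F x
  norm_smul c x := tsirelsonNorm_smul F c x
  norm_triangle x y := tsirelsonNorm_add_le F x y
  norm_eq_zero_iff x := by
    constructor
    · intro h
      refine Finsupp.ext fun n => abs_eq_zero.1 (le_antisymm ?_ (abs_nonneg _))
      exact (abs_le_tsirelsonNorm F x n).trans h.le
    · rintro rfl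
      have h : tsirelsonNorm F 0 = 0 := by simpa using tsirelsonNorm_smul F 0 0
      exact h

instance (F : Set (Finset ℕ+)) : NormedAddCommGroup (TsirelsonC00 F) :=
  NormedAddCommGroup.ofCore (tsirelsonC00_core F)

instance (F : Set (Finset ℕ+)) : NormedSpace ℝ (TsirelsonC00 F) :=
  NormedSpace.ofCore (tsirelsonC00_core F)

/-- The (real) Banach space `T[F, 1/2]`. -/
abbrev Tsirelson (F : Set (Finset ℕ+)) : Type := UniformSpace.Completion (TsirelsonC00 F)

/-- A finitely supported sequence as a vector of `T[F, 1/2]`. -/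
def tsirelsonOf (F : Set (Finset ℕ+)) (x : ℕ+ →₀ ℝ) : Tsirelson F :=
  ((show TsirelsonC00 F from x : TsirelsonC00 F) : UniformSpace.Completion (TsirelsonC00 F))

theorem norm_tsirelsonOf (F : Set (Finset ℕ+)) (x : ℕ+ →₀ ℝ) :
    ‖tsirelsonOf F x‖ = tsirelsonNorm F x :=
  UniformSpace.Completion.norm_coe _

/-! ### Schreier strictly singular operators -/

/-- `(xₙ)` is a basic sequence: a Schauder basis of its closed linear span. -/
def IsBasicSequence {X : Type*} [NormedAddCommGroup X] [NormedSpace ℝ X] (x : ℕ+ → X) : Prop :=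
  ∃ b : SchauderBasis ℝ (Submodule.span ℝ (Set.range x)).topologicalClosure,
    ∀ n : ℕ, (b n : X) = x n.succPNat

/-- The set `SS_ξ(X, Y)` of `S_ξ`-strictly singular operators. (The span of the finitely many `xᵢ`,
`i ∈ A`, is closed.) -/
def schreierSS (ladder : Ordinal.{0} → ℕ+ → Ordinal.{0}) (ξ : Ordinal.{0}) (X Y : Type*)
    [NormedAddCommGroup X] [NormedSpace ℝ X] [NormedAddCommGroup Y] [NormedSpace ℝ Y] :
    Set (X →L[ℝ] Y) :=
  {T | ∀ ε : ℝ, 0 < ε → ∀ x : ℕ+ → X, IsBasicSequence x →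
    ∃ A ∈ schreier ladder ξ, ∃ z ∈ Submodule.span ℝ (x '' (A : Set ℕ+)),
      z ≠ 0 ∧ ‖T z‖ ≤ ε * ‖z‖}

end

/-! ### Regular families -/

/-! Every member of `S_ξ` beyond some integer lies in `S_{ξω}`, so the norm of `Y` is dominated by a
multiple of the norm of `X`, and the formal inclusion exists. It is not `S_ξ`-strictly singular: on
unit vectors indexed by a set in `S_ξ`, the norm of `Y` is at least half the `ℓ₁`-norm, which
dominates the norm of `X` (`half_norm_le_formal_inclusion`).

The substance is `exists_norm_formal_inclusion_le`. Dimension counting in spans of consecutive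
vectors of a linearly independent sequence produces normalized vectors that are almost successive
blocks of `X`. A convex average of blocks whose weights are small on all members of `S_ξ` has its
`Y`-norm reduced by the factor `3/4` (`tsirelsonNorm_average_le`). Such weights exist with support
in `S_{ξ+1}` (`exists_special_convex_combination`), and `m` iterations (`exists_iterated_average`)
bring the `Y`-norm down to order `(3/4)^m`. The support of the iterated average lies in the `m`-fold
composition of `S_{ξ+1}`, which spreads into `S_{(ξ+1)m}` (`exists_image_iterFamily`). Since `1 +
(ξ+1)m < ξω`, the average remains admissible for `X`, where its norm stays above `1/4` after the
perturbation, and the indices used form a member of `S_{ξω}`.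

Inclusions between Schreier families hold only beyond some integer and after spreading. Index sets
are therefore pushed to the right, and regularity of the families absorbs the shift. -/

/-- A family is regular if it is hereditary and spreading: it contains every set `B` that embeds
into one of its members by a strictly increasing map `h` with `h b ≤ b`. -/
def IsRegularFamily (F : Set (Finset ℕ+)) : Prop :=
  ∀ A ∈ F, ∀ (B : Finset ℕ+) (h : ℕ+ → ℕ+), (∀ b ∈ B, h b ∈ A ∧ h b ≤ b) →
    StrictMonoOn h (B : Set ℕ+) → B ∈ F

theorem IsRegularFamily.mono {F : Set (Finset ℕ+)} (hF : IsRegularFamily F) {A B : Finset ℕ+}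
    (hA : A ∈ F) (hBA : B ⊆ A) : B ∈ F :=
  hF A hA B id (fun _ hb => ⟨hBA hb, le_rfl⟩) strictMonoOn_id

/-- Spreading for two increasing enumerations of one set: the required embedding is `φ` after the
inverse of `ψ` on `A`. -/
theorem IsRegularFamily.image_of_le {F : Set (Finset ℕ+)} (hF : IsRegularFamily F)
    {A : Finset ℕ+} {φ ψ : ℕ+ → ℕ+} (hA : A.image φ ∈ F) (hφ : StrictMonoOn φ (A : Set ℕ+))
    (hψ : StrictMonoOn ψ (A : Set ℕ+)) (hle : ∀ a ∈ A, φ a ≤ ψ a) : A.image ψ ∈ F := by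
  classical
  have hinv : ∀ a ∈ A, Function.invFunOn ψ (A : Set ℕ+) (ψ a) = a := fun a ha =>
    hψ.injOn.leftInvOn_invFunOn ha
  refine hF _ hA _ (fun b => φ (Function.invFunOn ψ (A : Set ℕ+) b)) ?_ ?_
  · intro b hb
    obtain ⟨a, ha, rfl⟩ := Finset.mem_image.1 hb
    simp only [hinv a ha]
    exact ⟨Finset.mem_image_of_mem _ ha, hle a ha⟩
  · intro b hb b' hb' hlt
    obtain ⟨a, ha, rfl⟩ := Finset.mem_image.1 (Finset.mem_coe.1 hb)
    obtain ⟨a', ha', rfl⟩ := Finset.mem_image.1 (Finset.mem_coe.1 hb')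
    simp only [hinv a ha, hinv a' ha']
    exact hφ ha ha' ((hψ.lt_iff_lt ha ha').1 hlt)

theorem isRegularFamily_card_le (d : ℕ) :
    IsRegularFamily {A : Finset ℕ+ | A.card ≤ d} := by
  intro A hA B h hB hmono
  exact (Finset.card_le_card_of_injOn h (fun b hb => (hB b hb).1) hmono.injOn).trans hA

theorem isRegularFamily_schreierOne : IsRegularFamily schreierOne := by
  intro A hA B h hB hmono b hb
  refine (Finset.card_le_card_of_injOn h (fun b hb => (hB b hb).1) hmono.injOn).trans ?_
  exact (hA _ (hB b hb).1).trans (hB b hb).2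

/-- A member of `F[G]`, coloured by the minimum of the piece that an element belongs to. -/
theorem exists_coloring_of_mem_familyComp {F G : Set (Finset ℕ+)} {A : Finset ℕ+}
    (hA : A ∈ familyComp F G) :
    ∃ c : ℕ+ → ℕ+, MonotoneOn c (A : Set ℕ+) ∧ (∀ a ∈ A, c a ≤ a ∧ c a ∈ A) ∧
      A.image c ∈ F ∧ ∀ m ∈ A.image c, A.filter (c · = m) ∈ G := by
  classical
  obtain ⟨d, E, hEG, ⟨hlt, m, hm, hmF⟩, rfl⟩ := hA
  have hex : ∀ a : ℕ+, ∃ k : ℕ+, ∀ i, a ∈ E i → k = m i := by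
    intro a
    by_cases h : ∃ i, a ∈ E i
    · obtain ⟨i, hi⟩ := h
      refine ⟨m i, fun j hj => ?_⟩
      rcases lt_trichotomy i j with h | rfl | h
      · exact absurd (hlt i j h a hi a hj) (lt_irrefl _)
      · rfl
      · exact absurd (hlt j i h a hj a hi) (lt_irrefl _)
    · exact ⟨1, fun i hi => absurd ⟨i, hi⟩ h⟩
  choose c hc using hex
  have himg : (Finset.univ.biUnion E).image c = Finset.univ.image m := by
    ext k
    simp only [Finset.mem_image, Finset.mem_biUnion, Finset.mem_univ, true_and]
    constructor
    · rintro ⟨a, ⟨i, hi⟩, rfl⟩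
      exact ⟨i, (hc a i hi).symm⟩
    · rintro ⟨i, rfl⟩
      exact ⟨m i, ⟨i, (hm i).1⟩, hc _ i (hm i).1⟩
  have hmm : ∀ i j, i < j → m i < m j := fun i j h => hlt i j h _ (hm i).1 _ (hm j).1
  refine ⟨c, ?_, ?_, by rwa [himg], ?_⟩
  · intro a ha b hb hab
    simp only [Finset.coe_biUnion, Finset.coe_univ, Set.mem_univ, Set.iUnion_true,
      Set.mem_iUnion, Finset.mem_coe] at ha hb
    obtain ⟨i, hi⟩ := ha
    obtain ⟨j, hj⟩ := hb
    rw [hc a i hi, hc b j hj]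
    rcases lt_trichotomy i j with h | rfl | h
    · exact (hmm i j h).le
    · exact le_rfl
    · exact absurd (hlt j i h b hj a hi) (not_lt.2 hab)
  · intro a ha
    obtain ⟨i, -, hi⟩ := Finset.mem_biUnion.1 ha
    rw [hc a i hi]
    exact ⟨(hm i).2 hi, Finset.mem_biUnion.2 ⟨i, Finset.mem_univ _, (hm i).1⟩⟩
  · intro k hk
    rw [himg] at hk
    obtain ⟨i, -, rfl⟩ := Finset.mem_image.1 hk
    convert hEG i using 1
    ext a
    simp only [Finset.mem_filter, Finset.mem_biUnion, Finset.mem_univ, true_and]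
    constructor
    · rintro ⟨⟨j, hj⟩, h⟩
      rw [hc a j hj] at h
      have hij : j = i := by
        rcases lt_trichotomy i j with h' | h' | h'
        · exact absurd h (hmm i j h').ne'
        · exact h'.symm
        · exact absurd h (hmm j i h').ne
      exact hij ▸ hj
    · exact fun hi => ⟨⟨i, hi⟩, hc a i hi⟩

/-- The colour classes of a monotone map are successive. A colour need not be the minimum of its
class, only a lower bound for it; spreading in `F` passes from colours to minima. Colourings thus
avoid all bookkeeping with indexed pieces. -/
theorem mem_familyComp_of_coloring {F G : Set (Finset ℕ+)} (hF : IsRegularFamily F)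
    {A : Finset ℕ+} (c : ℕ+ → ℕ+) (hc : MonotoneOn c (A : Set ℕ+)) (hle : ∀ a ∈ A, c a ≤ a)
    (hcF : A.image c ∈ F) (hG : ∀ m ∈ A.image c, A.filter (c · = m) ∈ G) :
    A ∈ familyComp F G := by
  classical
  set M := A.image c with hM
  let e := M.orderEmbOfFin rfl
  have heM : ∀ i, e i ∈ M := fun i => M.orderEmbOfFin_mem rfl i
  let E : Fin M.card → Finset ℕ+ := fun i => A.filter (c · = e i)
  have hne : ∀ i, (E i).Nonempty := by
    intro i
    obtain ⟨a, ha, hai⟩ := Finset.mem_image.1 (heM i)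
    exact ⟨a, Finset.mem_filter.2 ⟨ha, hai⟩⟩
  have hlt : ∀ i j, i < j → ∀ a ∈ E i, ∀ b ∈ E j, a < b := by
    intro i j hij a ha b hb
    obtain ⟨ha, hai⟩ := Finset.mem_filter.1 ha
    obtain ⟨hb, hbj⟩ := Finset.mem_filter.1 hb
    by_contra hba
    have := hc hb ha (not_lt.1 hba)
    rw [hai, hbj] at this
    exact absurd (e.strictMono hij) (not_lt.2 this)
  refine ⟨M.card, E, fun i => hG _ (heM i), ⟨hlt, fun i => (E i).min' (hne i), ?_, ?_⟩, ?_⟩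
  · exact fun i => (E i).isLeast_min' _
  · refine hF M hcF _ c ?_ ?_
    · intro b hb
      obtain ⟨i, -, rfl⟩ := Finset.mem_image.1 hb
      have h := Finset.mem_filter.1 ((E i).min'_mem (hne i))
      exact ⟨Finset.mem_image_of_mem _ h.1, hle _ h.1⟩
    · intro b hb b' hb' hbb'
      obtain ⟨i, -, rfl⟩ := Finset.mem_image.1 (Finset.mem_coe.1 hb)
      obtain ⟨j, -, rfl⟩ := Finset.mem_image.1 (Finset.mem_coe.1 hb')
      have h := Finset.mem_filter.1 ((E i).min'_mem (hne i))
      have h' := Finset.mem_filter.1 ((E j).min'_mem (hne j))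
      rw [h.2, h'.2]
      refine e.strictMono ?_
      by_contra hij
      rcases (not_lt.1 hij).eq_or_lt with rfl | hij
      · exact lt_irrefl _ hbb'
      · exact lt_asymm hbb' (hlt j i hij _ ((E j).min'_mem _) _ ((E i).min'_mem _))
  · ext a
    simp only [Finset.mem_biUnion, Finset.mem_univ, true_and, E, Finset.mem_filter]
    constructor
    · intro ha
      have : c a ∈ Set.range e := by
        rw [M.range_orderEmbOfFin rfl]; exact Finset.mem_image_of_mem _ ha
      obtain ⟨i, hi⟩ := this
      exact ⟨i, ha, hi.symm⟩
    · rintro ⟨_, ha, _⟩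
      exact ha

/-- A colouring pulls back along the embedding, and colours stay below elements because the
embedding moves points to the left. -/
theorem IsRegularFamily.familyComp {F G : Set (Finset ℕ+)} (hF : IsRegularFamily F)
    (hG : IsRegularFamily G) : IsRegularFamily (familyComp F G) := by
  intro A hA B h hB hmono
  obtain ⟨c, hc, hcA, hcF, hcG⟩ := exists_coloring_of_mem_familyComp hA
  refine mem_familyComp_of_coloring hF (fun b => c (h b)) ?_ ?_ ?_ ?_
  · exact fun b hb b' hb' hle => hc (hB b hb).1 (hB b' hb').1 (hmono.monotoneOn hb hb' hle)
  · exact fun b hb => (hcA _ (hB b hb).1).1.trans (hB b hb).2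
  · refine hF.mono hcF fun m hm => ?_
    obtain ⟨b, hb, rfl⟩ := Finset.mem_image.1 hm
    exact Finset.mem_image_of_mem _ (hB b hb).1
  · intro m hm
    obtain ⟨b, hb, rfl⟩ := Finset.mem_image.1 hm
    refine hG _ (hcG _ (Finset.mem_image_of_mem _ (hB b hb).1)) _ h ?_ ?_
    · intro b' hb'
      obtain ⟨hb', he⟩ := Finset.mem_filter.1 hb'
      exact ⟨Finset.mem_filter.2 ⟨(hB b' hb').1, he⟩, (hB b' hb').2⟩
    · exact hmono.mono fun _ hx => (Finset.mem_filter.1 hx).1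

theorem subset_familyComp_schreierOne {G : Set (Finset ℕ+)} :
    G ⊆ familyComp schreierOne G := by
  intro A hA
  rcases A.eq_empty_or_nonempty with rfl | hne
  · refine mem_familyComp_of_coloring isRegularFamily_schreierOne id ?_ ?_ ?_ ?_ <;>
      simp [schreierOne, MonotoneOn]
  · refine mem_familyComp_of_coloring isRegularFamily_schreierOne (fun _ => A.min' hne)
      monotoneOn_const (fun a ha => A.min'_le a ha) ?_ ?_
    · rw [Finset.image_const hne]
      intro n _
      rw [Finset.card_singleton]
      exact n.2
    · intro m hm
      obtain ⟨_, _, rfl⟩ := Finset.mem_image.1 hm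
      simpa using hA

/-- One half of the associativity of the composition of families. -/
theorem familyComp_assoc_subset {F G H : Set (Finset ℕ+)} (hF : IsRegularFamily F)
    (hG : IsRegularFamily G) :
    familyComp (familyComp F G) H ⊆ familyComp F (familyComp G H) := by
  intro A hA
  obtain ⟨c, hc, hcA, hcF, hcG⟩ := exists_coloring_of_mem_familyComp hA
  obtain ⟨k, hk, hkA, hkF, hkG⟩ := exists_coloring_of_mem_familyComp hcF
  have hcm : ∀ a ∈ A, c a ∈ A.image c := fun a ha => Finset.mem_image_of_mem _ ha
  -- The coarse colouring is `k ∘ c`; within one of its classes, `c` itself is the fine colouring.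
  refine mem_familyComp_of_coloring hF (fun a => k (c a)) ?_ ?_ ?_ ?_
  · exact fun a ha b hb hab => hk (hcm a ha) (hcm b hb) (hc ha hb hab)
  · exact fun a ha => (hkA _ (hcm a ha)).1.trans (hcA a ha).1
  · rwa [Finset.image_image] at hkF
  · intro m hm
    obtain ⟨a₀, ha₀, rfl⟩ := Finset.mem_image.1 hm
    refine mem_familyComp_of_coloring hG c (hc.mono fun _ hx => (Finset.mem_filter.1 hx).1)
      (fun a ha => (hcA a (Finset.mem_filter.1 ha).1).1) ?_ ?_
    · refine hG.mono (hkG _ (Finset.mem_image_of_mem k (hcm a₀ ha₀))) ?_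
      intro n hn
      obtain ⟨a, ha, rfl⟩ := Finset.mem_image.1 hn
      obtain ⟨ha, he⟩ := Finset.mem_filter.1 ha
      exact Finset.mem_filter.2 ⟨hcm a ha, he⟩
    · intro n hn
      obtain ⟨a, ha, rfl⟩ := Finset.mem_image.1 hn
      obtain ⟨ha, he⟩ := Finset.mem_filter.1 ha
      convert hcG _ (hcm a ha) using 1
      ext b
      simp only [Finset.mem_filter]
      constructor
      · exact fun h => ⟨h.1.1, h.2⟩
      · rintro ⟨hb, hbc⟩
        exact ⟨⟨hb, by rw [hbc, he]⟩, hbc⟩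

/-- Elements move to the right but keep their old colours, so the set of colours is unchanged and
only the pieces have to be transported. -/
theorem image_mem_familyComp {F G G' : Set (Finset ℕ+)} (hF : IsRegularFamily F) {φ : ℕ+ → ℕ+}
    (hφ : StrictMono φ) (hG : ∀ A ∈ G, A.image φ ∈ G') {A : Finset ℕ+}
    (hA : A ∈ familyComp F G) : A.image φ ∈ familyComp F G' := by
  obtain ⟨c, hc, hcA, hcF, hcG⟩ := exists_coloring_of_mem_familyComp hA
  have hinv : ∀ a, Function.invFun φ (φ a) = a := Function.leftInverse_invFun hφ.injective
  refine mem_familyComp_of_coloring hF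
    (fun b => c (Function.invFun φ b)) ?_ ?_ ?_ ?_
  · intro b hb b' hb' hle
    obtain ⟨a, ha, rfl⟩ := Finset.mem_image.1 (Finset.mem_coe.1 hb)
    obtain ⟨a', ha', rfl⟩ := Finset.mem_image.1 (Finset.mem_coe.1 hb')
    simp only [hinv]
    exact hc ha ha' (hφ.le_iff_le.1 hle)
  · intro b hb
    obtain ⟨a, ha, rfl⟩ := Finset.mem_image.1 hb
    simp only [hinv]
    exact (hcA a ha).1.trans (hφ.le_apply)
  · rw [Finset.image_image]
    convert hcF using 2
    ext a
    simp [hinv]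
  · intro m hm
    obtain ⟨b, hb, rfl⟩ := Finset.mem_image.1 hm
    obtain ⟨a, ha, rfl⟩ := Finset.mem_image.1 hb
    convert hG _ (hcG (c a) (Finset.mem_image_of_mem _ ha)) using 1
    ext b
    simp only [Finset.mem_filter, Finset.mem_image, hinv]
    constructor
    · rintro ⟨⟨a', ha', rfl⟩, h⟩
      exact ⟨a', ⟨ha', by rwa [hinv] at h⟩, rfl⟩
    · rintro ⟨a', ⟨ha', h⟩, rfl⟩
      exact ⟨⟨a', ha', rfl⟩, by rwa [hinv]⟩

/-- The partial sums of `f` work, since its values are positive. -/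
theorem exists_strictMono_ge (f : ℕ+ → ℕ+) : ∃ φ : ℕ+ → ℕ+, StrictMono φ ∧ ∀ n, f n ≤ φ n := by
  have hpos : ∀ n : ℕ+, 0 < ∑ j ∈ Finset.Icc 1 n, (f j : ℕ) := fun n =>
    Finset.sum_pos (fun j _ => (f j).2) ⟨n, by simp⟩
  have hcoe : ∀ n, ((Nat.toPNat _ (hpos n) : ℕ+) : ℕ) = ∑ j ∈ Finset.Icc 1 n, (f j : ℕ) :=
    fun _ => rfl
  refine ⟨fun n => Nat.toPNat _ (hpos n), ?_, ?_⟩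
  · intro a b hab
    rw [← PNat.coe_lt_coe, hcoe, hcoe]
    refine Finset.sum_lt_sum_of_subset (i := b) (Finset.Icc_subset_Icc le_rfl hab.le)
      (Finset.mem_Icc.2 ⟨one_le, le_rfl⟩) ?_ (f b).2 fun _ _ _ => Nat.zero_le _
    exact fun h => absurd (Finset.mem_Icc.1 h).2 (not_le.2 hab)
  · intro n
    rw [← PNat.coe_le_coe, hcoe]
    exact Finset.single_le_sum (f := fun j => (f j : ℕ)) (fun _ _ => Nat.zero_le _)
      (Finset.mem_Icc.2 ⟨one_le, le_rfl⟩)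

/-! ### The Schreier families -/

section Schreier

variable {ladder : Ordinal.{0} → ℕ+ → Ordinal.{0}}

theorem IsLadderSystem.lt (hl : IsLadderSystem ladder) {ζ : Ordinal.{0}} (hζ : IsSuccLimit ζ)
    (hζ' : ζ < ω₁) (n : ℕ+) : ladder ζ n < ζ :=
  ((hl ζ hζ hζ').1 (PNat.lt_add_right n 1)).trans_le ((hl ζ hζ hζ').2.1 ⟨n + 1, rfl⟩)

theorem IsLadderSystem.exists_lt (hl : IsLadderSystem ladder) {ζ : Ordinal.{0}}
    (hζ : IsSuccLimit ζ) (hζ' : ζ < ω₁) {α : Ordinal.{0}} (hα : α < ζ) :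
    ∃ n, α < ladder ζ n := by
  obtain ⟨_, ⟨n, rfl⟩, h⟩ := (lt_isLUB_iff (hl ζ hζ hζ').2).1 hα
  exact ⟨n, h⟩

/-- Induction on countable ordinals. -/
theorem countable_ordinal_induction {P : Ordinal.{0} → Prop} (zero : P 0)
    (succ : ∀ o, o < ω₁ → P o → P (o + 1))
    (limit : ∀ o, IsSuccLimit o → o < ω₁ → (∀ o' < o, P o') → P o) : ∀ o < ω₁, P o := by
  intro o
  induction o using Ordinal.limitRecOn with
  | zero => exact fun _ => zero
  | add_one o ih =>
    intro ho
    have : o < ω₁ := (Order.lt_add_one_iff.2 le_rfl).trans ho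
    exact succ o this (ih this)
  | limit o ho ih => exact fun h => limit o ho h fun o' h' => ih o' h' (h'.trans h)

theorem isRegularFamily_schreier (hl : IsLadderSystem ladder) :
    ∀ ξ < ω₁, IsRegularFamily (schreier ladder ξ) := by
  refine countable_ordinal_induction ?_ ?_ ?_
  · rw [schreier_zero]
    exact isRegularFamily_card_le 1
  · intro o _ ih
    rw [schreier_succ]
    exact isRegularFamily_schreierOne.familyComp ih
  · intro o ho ho' ih
    rw [schreier_limit hl ho ho']
    rintro A ⟨n, hn, hA⟩ B h hB hmono
    exact ⟨n, fun b hb => (hn _ (hB b hb).1).trans (hB b hb).2,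
      ih _ (hl.lt ho ho' n) A hA B h hB hmono⟩

theorem schreierZero_subset (hl : IsLadderSystem ladder) :
    ∀ ξ < ω₁, schreierZero ⊆ schreier ladder ξ := by
  refine countable_ordinal_induction ?_ ?_ ?_
  · rw [schreier_zero]
  · intro o _ ih
    rw [schreier_succ]
    exact ih.trans subset_familyComp_schreierOne
  · intro o ho ho' ih A hA
    rw [schreier_limit hl ho ho']
    exact ⟨1, fun k _ => one_le, ih _ (hl.lt ho ho' 1) hA⟩

/-- Up to a finite set of integers the Schreier families increase. -/
theorem schreier_subset_of_le (hl : IsLadderSystem ladder) {α : Ordinal.{0}} :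
    ∀ β < ω₁, α ≤ β → ∃ n : ℕ+, ∀ A ∈ schreier ladder α, (∀ a ∈ A, n ≤ a) →
      A ∈ schreier ladder β := by
  refine countable_ordinal_induction ?_ ?_ ?_
  · intro h
    rw [nonpos_iff_eq_zero.1 h]
    exact ⟨1, fun A hA _ => hA⟩
  · intro o _ ih h
    rcases h.eq_or_lt with rfl | h
    · exact ⟨1, fun A hA _ => hA⟩
    · obtain ⟨n, hn⟩ := ih (Order.lt_add_one_iff.1 h)
      refine ⟨n, fun A hA hnA => ?_⟩
      rw [schreier_succ]
      exact subset_familyComp_schreierOne (hn A hA hnA)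
  · intro o ho ho' ih h
    rcases h.eq_or_lt with rfl | h
    · exact ⟨1, fun A hA _ => hA⟩
    · obtain ⟨k, hk⟩ := hl.exists_lt ho ho' h
      -- The threshold must also exceed `k`, to meet the condition on the minimum in the limit
      -- family.
      obtain ⟨n, hn⟩ := ih _ (hl.lt ho ho' k) hk.le
      refine ⟨max n k, fun A hA hA' => ?_⟩
      rw [schreier_limit hl ho ho']
      exact ⟨k, fun a ha => (le_max_right _ _).trans (hA' a ha),
        hn A hA fun a ha => (le_max_left _ _).trans (hA' a ha)⟩

/-! ### Compositions of Schreier families and ordinal sums. -/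

theorem add_lt_omega_one {α β : Ordinal.{0}} (hα : α < ω₁) (hβ : β < ω₁) : α + β < ω₁ :=
  Ordinal.isPrincipal_add_omega 1 hα hβ

theorem add_one_lt_omega_one {α : Ordinal.{0}} (hα : α < ω₁) : α + 1 < ω₁ :=
  add_lt_omega_one hα (Ordinal.one_lt_omega0.trans Ordinal.omega0_lt_omega_one)

theorem mul_lt_omega_one {α β : Ordinal.{0}} (hα : α < ω₁) (hβ : β < ω₁) : α * β < ω₁ :=
  Ordinal.isPrincipal_mul_omega 1 hα hβ

/-- `S_α[S_β]` embeds into `S_{β + α}` by spreading. -/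
theorem exists_image_familyComp_schreier (hl : IsLadderSystem ladder) {β : Ordinal.{0}}
    (hβ : β < ω₁) : ∀ α < ω₁, ∃ φ : ℕ+ → ℕ+, StrictMono φ ∧
      ∀ A ∈ familyComp (schreier ladder α) (schreier ladder β),
        A.image φ ∈ schreier ladder (β + α) := by
  refine countable_ordinal_induction ?_ ?_ ?_
  · refine ⟨id, strictMono_id, fun A hA => ?_⟩
    obtain ⟨c, hc, hcA, hcF, hcG⟩ := exists_coloring_of_mem_familyComp hA
    rw [Finset.image_id, add_zero]
    rcases A.eq_empty_or_nonempty with rfl | ⟨a, ha⟩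
    · exact schreierZero_subset hl β hβ (by simp [schreierZero])
    · convert hcG (c a) (Finset.mem_image_of_mem _ ha)
      refine (Finset.filter_true_of_mem fun b hb => ?_).symm
      rw [schreier_zero] at hcF
      exact Finset.card_le_one.1 hcF _ (Finset.mem_image_of_mem _ hb) _
        (Finset.mem_image_of_mem _ ha)
  · rintro o ho ⟨φ, hφ, hφA⟩
    refine ⟨φ, hφ, fun A hA => ?_⟩
    rw [schreier_succ] at hA
    have hA := familyComp_assoc_subset isRegularFamily_schreierOne
      (isRegularFamily_schreier hl o ho) hA
    rw [← add_assoc, schreier_succ]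
    exact image_mem_familyComp isRegularFamily_schreierOne hφ hφA hA
  · intro o ho ho' ih
    have hlt := hl.lt ho ho'
    choose φ hφ hφA using fun n => ih _ (hlt n)
    have hβo := add_lt_omega_one hβ ho'
    -- The ladder of `β + o` is unrelated to that of `o`, so `S_{β+o}` is not unfolded; it is
    -- reached from `S_{β + ladder o n}` beyond the threshold `t n`.
    choose t ht using fun n => schreier_subset_of_le hl (β + o) hβo
      (add_le_add le_rfl (hlt n).le : β + ladder o n ≤ β + o)
    -- Diagonalization: a set belonging to the family through the `k`-th ladder term lives in `[k,
    -- ∞)`, so at position `i` only the finitely many maps with `k ≤ i` must be dominated.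
    obtain ⟨ψ, hψ, hψle⟩ := exists_strictMono_ge
      (fun i => (Finset.Icc 1 i).sup' ⟨i, by simp⟩ fun k => max (φ k i) (t k))
    have hψ' : ∀ k i, k ≤ i → φ k i ≤ ψ i ∧ t k ≤ ψ i := by
      intro k i hki
      have := (Finset.le_sup' (fun k => max (φ k i) (t k))
        (Finset.mem_Icc.2 ⟨one_le, hki⟩)).trans (hψle i)
      exact max_le_iff.1 this
    refine ⟨ψ, hψ, fun A hA => ?_⟩
    obtain ⟨c, hc, hcA, hcF, hcG⟩ := exists_coloring_of_mem_familyComp hA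
    rw [schreier_limit hl ho ho'] at hcF
    obtain ⟨k, hk, hcF⟩ := hcF
    have hkA : ∀ a ∈ A, k ≤ a := fun a ha =>
      (hk _ (Finset.mem_image_of_mem _ ha)).trans (hcA a ha).1
    have h1 : A ∈ familyComp (schreier ladder (ladder o k)) (schreier ladder β) :=
      mem_familyComp_of_coloring (isRegularFamily_schreier hl _ ((hlt k).trans ho')) c hc
        (fun a ha => (hcA a ha).1) hcF hcG
    refine ht k _ ?_ ?_
    · refine (isRegularFamily_schreier hl _ (add_lt_omega_one hβ ((hlt k).trans ho'))).image_of_le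
        (hφA k A h1) ((hφ k).strictMonoOn _) (hψ.strictMonoOn _) fun a ha => ?_
      exact (hψ' k a (hkA a ha)).1
    · intro b hb
      obtain ⟨a, ha, rfl⟩ := Finset.mem_image.1 hb
      exact (hψ' k a (hkA a ha)).2

/-- The `m`-fold composition of `F` with itself. -/
def iterFamily (F : Set (Finset ℕ+)) : ℕ → Set (Finset ℕ+)
  | 0 => schreierZero
  | m + 1 => familyComp F (iterFamily F m)

/-- An outer `S_η` adds `η` on the right of the exponent, `η * m + η = η * (m + 1)`, and the
spreading maps compose. -/
theorem exists_image_iterFamily (hl : IsLadderSystem ladder) {η : Ordinal.{0}} (hη : η < ω₁)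
    (m : ℕ) : ∃ φ : ℕ+ → ℕ+, StrictMono φ ∧ ∀ A ∈ iterFamily (schreier ladder η) m,
      A.image φ ∈ schreier ladder (η * m) := by
  induction m with
  | zero =>
    refine ⟨id, strictMono_id, fun A hA => ?_⟩
    rw [Nat.cast_zero, mul_zero, schreier_zero, Finset.image_id]
    exact hA
  | succ m ih =>
    obtain ⟨φ, hφ, hφA⟩ := ih
    have hm : η * m < ω₁ :=
      mul_lt_omega_one hη ((Ordinal.natCast_lt_omega0 m).trans Ordinal.omega0_lt_omega_one)
    obtain ⟨ψ, hψ, hψA⟩ := exists_image_familyComp_schreier hl hm η hη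
    refine ⟨ψ ∘ φ, hψ.comp hφ, fun A hA => ?_⟩
    rw [← Finset.image_image, Nat.cast_succ, mul_add, mul_one]
    exact hψA _ (image_mem_familyComp (isRegularFamily_schreier hl η hη) hφ hφA hA)

end Schreier

/-! ### Special convex combinations -/

/-- The non-negative vectors of `c₀₀` with coordinate sum `s`. -/
def IsWeight (s : ℝ) (a : ℕ+ →₀ ℝ) : Prop := (∀ n, 0 ≤ a n) ∧ ∑ n ∈ a.support, a n = s

theorem sum_apply_support_eq {a : ℕ+ →₀ ℝ} {S : Finset ℕ+} (h : a.support ⊆ S) :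
    ∑ n ∈ S, a n = ∑ n ∈ a.support, a n :=
  (Finset.sum_subset h fun _ _ h => Finsupp.notMem_support_iff.1 h).symm

theorem IsWeight.add {s t : ℝ} {a b : ℕ+ →₀ ℝ} (ha : IsWeight s a) (hb : IsWeight t b) :
    IsWeight (s + t) (a + b) := by
  classical
  refine ⟨fun n => add_nonneg (ha.1 n) (hb.1 n), ?_⟩
  rw [← sum_apply_support_eq (S := a.support ∪ b.support) Finsupp.support_add]
  simp only [Finsupp.add_apply, Finset.sum_add_distrib]
  rw [sum_apply_support_eq Finset.subset_union_left, sum_apply_support_eq Finset.subset_union_right,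
    ha.2, hb.2]

theorem IsWeight.smul {s r : ℝ} {a : ℕ+ →₀ ℝ} (ha : IsWeight s a) (hr : 0 ≤ r) :
    IsWeight (r * s) (r • a) := by
  refine ⟨fun n => mul_nonneg hr (ha.1 n), ?_⟩
  rw [← sum_apply_support_eq (S := a.support) Finsupp.support_smul, ← ha.2, Finset.mul_sum]
  rfl

theorem IsWeight.sum_le {s : ℝ} {a : ℕ+ →₀ ℝ} (ha : IsWeight s a) (B : Finset ℕ+) :
    ∑ n ∈ B, a n ≤ s := by
  classical
  rw [← ha.2, ← sum_apply_support_eq (S := a.support ∪ B) Finset.subset_union_left]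
  exact Finset.sum_le_sum_of_subset_of_nonneg Finset.subset_union_right fun n _ _ => ha.1 n

theorem IsWeight.support_nonempty {a : ℕ+ →₀ ℝ} (ha : IsWeight 1 a) : a.support.Nonempty := by
  rw [Finset.nonempty_iff_ne_empty]
  intro h
  have := ha.2
  rw [h, Finset.sum_empty] at this
  exact zero_ne_one this

theorem sum_biUnion_le_sum {a : ℕ+ → ℝ} (ha : ∀ n, 0 ≤ a n) (𝒞 : Finset (Finset ℕ+)) :
    ∑ n ∈ 𝒞.biUnion id, a n ≤ ∑ C ∈ 𝒞, ∑ n ∈ C, a n := by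
  classical
  induction 𝒞 using Finset.induction_on with
  | empty => simp
  | insert C 𝒞 hC ih =>
    rw [Finset.biUnion_insert, Finset.sum_insert hC, id]
    refine le_trans ?_ (add_le_add le_rfl ih)
    rw [← Finset.sum_union_inter]
    exact le_add_of_nonneg_right (Finset.sum_nonneg fun n _ => ha n)

/-- The piece placed in front receives its minimum as a single new colour; all other colours are
kept. -/
theorem union_mem_familyComp_card_le {G : Set (Finset ℕ+)} {d : ℕ} {A B : Finset ℕ+} (hA : A ∈ G)
    (hAne : A.Nonempty) (hB : B ∈ familyComp {M | M.card ≤ d} G)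
    (hAB : ∀ a ∈ A, ∀ b ∈ B, a < b) : A ∪ B ∈ familyComp {M | M.card ≤ d + 1} G := by
  classical
  obtain ⟨c, hc, hcB, hcF, hcG⟩ := exists_coloring_of_mem_familyComp hB
  have hdisj : ∀ b ∈ B, b ∉ A := fun b hb ha => lt_irrefl _ (hAB b ha b hb)
  let k : ℕ+ → ℕ+ := fun n => if n ∈ A then A.min' hAne else c n
  have hkA : ∀ a ∈ A, k a = A.min' hAne := fun a ha => if_pos ha
  have hkB : ∀ b ∈ B, k b = c b := fun b hb => if_neg (hdisj b hb)
  have hlt : ∀ b ∈ B, A.min' hAne < c b := fun b hb => hAB _ (A.min'_mem _) _ (hcB b hb).2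
  refine mem_familyComp_of_coloring (isRegularFamily_card_le (d + 1)) k ?_ ?_ ?_ ?_
  · intro x hx y hy hxy
    rcases Finset.mem_union.1 (Finset.mem_coe.1 hx) with hx | hx <;>
      rcases Finset.mem_union.1 (Finset.mem_coe.1 hy) with hy | hy
    · rw [hkA x hx, hkA y hy]
    · rw [hkA x hx, hkB y hy]
      exact (hlt y hy).le
    · exact absurd (hAB y hy x hx) (not_lt.2 hxy)
    · rw [hkB x hx, hkB y hy]
      exact hc hx hy hxy
  · intro x hx
    rcases Finset.mem_union.1 hx with hx | hx
    · rw [hkA x hx]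
      exact A.min'_le x hx
    · rw [hkB x hx]
      exact (hcB x hx).1
  · have : (A ∪ B).image k ⊆ insert (A.min' hAne) (B.image c) := by
      intro m hm
      obtain ⟨x, hx, rfl⟩ := Finset.mem_image.1 hm
      rcases Finset.mem_union.1 hx with hx | hx
      · rw [hkA x hx]
        exact Finset.mem_insert_self _ _
      · rw [hkB x hx]
        exact Finset.mem_insert_of_mem (Finset.mem_image_of_mem _ hx)
    exact (Finset.card_le_card this).trans
      ((Finset.card_insert_le _ _).trans (Nat.succ_le_succ hcF))
  · intro m hm
    obtain ⟨x, hx, rfl⟩ := Finset.mem_image.1 hm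
    rcases Finset.mem_union.1 hx with hx | hx
    · convert hA using 1
      ext y
      rw [Finset.mem_filter, hkA x hx]
      constructor
      · rintro ⟨hy, hyx⟩
        rcases Finset.mem_union.1 hy with hy | hy
        · exact hy
        · rw [hkB y hy] at hyx
          exact absurd hyx (hlt y hy).ne'
      · exact fun hy => ⟨Finset.mem_union_left _ hy, hkA y hy⟩
    · convert hcG _ (Finset.mem_image_of_mem _ hx) using 1
      ext y
      rw [Finset.mem_filter, Finset.mem_filter, hkB x hx]
      constructor
      · rintro ⟨hy, hyx⟩
        rcases Finset.mem_union.1 hy with hy | hy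
        · rw [hkA y hy] at hyx
          exact absurd hyx (hlt x hx).ne
        · exact ⟨hy, by rwa [hkB y hy] at hyx⟩
      · rintro ⟨hy, hyx⟩
        exact ⟨Finset.mem_union_right _ hy, by rwa [hkB y hy]⟩

section Schreier

variable {ladder : Ordinal.{0} → ℕ+ → Ordinal.{0}}

/-- The members of `S_ξ` with bounded minimum are, up to finitely many integers, covered by
boundedly many members of some `S_η`, `η < ξ`. -/
theorem exists_schreier_cover (hl : IsLadderSystem ladder) {ξ : Ordinal.{0}} (hξ : ξ < ω₁)
    (h0 : ξ ≠ 0) (t : ℕ+) : ∃ η < ξ, ∃ (s : ℕ+) (D : ℕ), ∀ B ∈ schreier ladder ξ,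
      (∃ b ∈ B, b ≤ t) → ∃ 𝒞 : Finset (Finset ℕ+), 𝒞.card ≤ D ∧
        (∀ C ∈ 𝒞, C ∈ schreier ladder η) ∧ B.filter (s ≤ ·) ⊆ 𝒞.biUnion id := by
  classical
  rcases Ordinal.zero_or_succ_or_isSuccLimit ξ with rfl | ⟨η, rfl⟩ | hlim
  · exact absurd rfl h0
  · refine ⟨η, Order.lt_succ η, 1, t, ?_⟩
    rintro B hB ⟨b, hb, hbt⟩
    rw [Order.succ_eq_add_one, schreier_succ] at hB
    obtain ⟨c, hc, hcB, hcF, hcG⟩ := exists_coloring_of_mem_familyComp hB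
    refine ⟨(B.image c).image fun m => B.filter (c · = m), ?_, ?_, ?_⟩
    · refine Finset.card_image_le.trans ((hcF _ (Finset.mem_image_of_mem _ hb)).trans ?_)
      exact (hcB b hb).1.trans hbt
    · intro C hC
      obtain ⟨m, hm, rfl⟩ := Finset.mem_image.1 hC
      exact hcG m hm
    · intro x hx
      have hx := (Finset.mem_filter.1 hx).1
      exact Finset.mem_biUnion.2 ⟨_, Finset.mem_image_of_mem _ (Finset.mem_image_of_mem _ hx),
        Finset.mem_filter.2 ⟨hx, rfl⟩⟩
  · have hlt := hl.lt hlim hξ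
    -- A member with an element at most `t` comes from a ladder term with index `n ≤ t`. Far enough
    -- out all these finitely many families lie in the `t`-th one, so a single covering set
    -- suffices.
    have hex : ∀ n, ∃ s : ℕ+, n ≤ t → ∀ A ∈ schreier ladder (ladder ξ n), (∀ a ∈ A, s ≤ a) →
        A ∈ schreier ladder (ladder ξ t) := by
      intro n
      by_cases hn : n ≤ t
      · obtain ⟨s, hs⟩ := schreier_subset_of_le hl _ ((hlt t).trans hξ)
          ((hl ξ hlim hξ).1.monotone hn)
        exact ⟨s, fun _ => hs⟩
      · exact ⟨1, fun h => absurd h hn⟩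
    choose s hs using hex
    refine ⟨ladder ξ t, hlt t, (Finset.Icc 1 t).sup' ⟨t, by simp⟩ s, 1, ?_⟩
    rintro B hB ⟨b, hb, hbt⟩
    rw [schreier_limit hl hlim hξ] at hB
    obtain ⟨n, hn, hB⟩ := hB
    have hnt := (hn b hb).trans hbt
    refine ⟨{B.filter ((Finset.Icc 1 t).sup' ⟨t, by simp⟩ s ≤ ·)}, by simp, ?_, by simp⟩
    intro C hC
    rw [Finset.mem_singleton.1 hC]
    refine hs n hnt _ ((isRegularFamily_schreier hl _ ((hlt n).trans hξ)).mono hB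
      (Finset.filter_subset _ _)) fun a ha => ?_
    exact (Finset.le_sup' s (Finset.mem_Icc.2 ⟨one_le, hnt⟩)).trans (Finset.mem_filter.1 ha).2

/-- Special convex combinations: probability vectors with support in `S_{ξ+1}` that give small
weight to all members of `S_ξ`. -/
theorem exists_special_convex_combination (hl : IsLadderSystem ladder) {L : Set ℕ+}
    (hL : L.Infinite) : ∀ ξ < ω₁, ∀ (N : ℕ+) (δ : ℝ), 0 < δ → ∃ a : ℕ+ →₀ ℝ, IsWeight 1 a ∧
      (∀ n ∈ a.support, n ∈ L ∧ N ≤ n) ∧ a.support ∈ schreier ladder (ξ + 1) ∧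
      ∀ B ∈ schreier ladder ξ, ∑ n ∈ B, a n ≤ δ := by
  classical
  intro ξ
  induction ξ using WellFoundedLT.induction with
  | _ ξ ih =>
  intro hξ N δ hδ
  have hreg := isRegularFamily_schreier hl ξ hξ
  -- one piece, small on the members of `S_ξ` with minimum at most `t`
  have piece : ∀ (t N : ℕ+) (η : ℝ), 0 < η → ∃ a : ℕ+ →₀ ℝ, IsWeight 1 a ∧
      (∀ n ∈ a.support, n ∈ L ∧ N ≤ n) ∧ a.support ∈ schreier ladder ξ ∧
      ∀ B ∈ schreier ladder ξ, (∃ b ∈ B, b ≤ t) → ∑ n ∈ B, a n ≤ η := by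
    intro t N η hη
    by_cases h0 : ξ = 0
    · subst h0
      obtain ⟨n, hnL, hn⟩ := hL.exists_gt (max t N)
      have hsupp : (Finsupp.single n (1 : ℝ)).support = {n} :=
        Finsupp.support_single _ one_ne_zero
      refine ⟨Finsupp.single n 1, ⟨fun k => ?_, ?_⟩, ?_, ?_, ?_⟩
      · rw [Finsupp.single_apply]
        split_ifs <;> norm_num
      · rw [hsupp, Finset.sum_singleton, Finsupp.single_eq_same]
      · rw [hsupp]
        intro k hk
        rw [Finset.mem_singleton.1 hk]
        exact ⟨hnL, (le_max_right _ _).trans hn.le⟩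
      · rw [hsupp, schreier_zero]
        simp [schreierZero]
      · rintro B hB ⟨b, hb, hbt⟩
        rw [schreier_zero] at hB
        refine (Finset.sum_eq_zero fun k hk => ?_).trans_le hη.le
        have hkb : k = b := Finset.card_le_one.1 hB _ hk _ hb
        rw [Finsupp.single_apply, if_neg]
        rintro rfl
        exact absurd ((le_max_left _ _).trans_lt hn) (not_lt.2 (hkb ▸ hbt))
    · obtain ⟨ζ, hζ, s, D, hsD⟩ := exists_schreier_cover hl hξ h0 t
      have hζ1 : ζ + 1 ≤ ξ := Order.add_one_le_iff.2 hζ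
      obtain ⟨r, hr⟩ := schreier_subset_of_le hl ξ hξ hζ1
      -- A set to be estimated is covered, on the support of `a`, by at most `D` members of `S_ζ`,
      -- each of weight at most `η / (D + 1)`.
      obtain ⟨a, ha1, haL, haS, haB⟩ := ih ζ hζ (hζ.trans hξ) (max N (max s r)) (η / (D + 1))
        (by positivity)
      refine ⟨a, ha1, fun n hn => ⟨(haL n hn).1, (le_max_left _ _).trans (haL n hn).2⟩,
        hr _ haS fun n hn => ?_, fun B hB hBt => ?_⟩
      · exact (le_max_right _ _).trans ((le_max_right _ _).trans (haL n hn).2)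
      · obtain ⟨𝒞, hcard, h𝒞, hcov⟩ := hsD B hB hBt
        have h1 : ∑ n ∈ B, a n = ∑ n ∈ B.filter (s ≤ ·), a n := by
          refine (Finset.sum_subset (Finset.filter_subset _ _) fun n hn hn' => ?_).symm
          by_contra h
          exact hn' (Finset.mem_filter.2 ⟨hn, (le_max_left _ _).trans
            ((le_max_right _ _).trans (haL n (Finsupp.mem_support_iff.2 h)).2)⟩)
        rw [h1]
        calc ∑ n ∈ B.filter (s ≤ ·), a n ≤ ∑ n ∈ 𝒞.biUnion id, a n :=
              Finset.sum_le_sum_of_subset_of_nonneg hcov fun n _ _ => ha1.1 n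
          _ ≤ ∑ C ∈ 𝒞, ∑ n ∈ C, a n :=
              sum_biUnion_le_sum ha1.1 𝒞
          _ ≤ ∑ C ∈ 𝒞, η / (D + 1) := Finset.sum_le_sum fun C hC => haB C (h𝒞 C hC)
          _ = 𝒞.card * (η / (D + 1)) := by rw [Finset.sum_const, nsmul_eq_mul]
          _ ≤ D * (η / (D + 1)) := by gcongr
          _ ≤ η := by
              rw [mul_div_assoc', div_le_iff₀ (by positivity)]
              nlinarith
  -- many successive pieces
  have pieces : ∀ (d : ℕ) (t N : ℕ+) (η : ℝ), 0 < η → ∃ b : ℕ+ →₀ ℝ, IsWeight d b ∧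
      (∀ n ∈ b.support, n ∈ L ∧ N ≤ n) ∧
      b.support ∈ familyComp {M | M.card ≤ d} (schreier ladder ξ) ∧
      (∀ B ∈ schreier ladder ξ, ∑ n ∈ B, b n ≤ 1 + η) ∧
      ∀ B ∈ schreier ladder ξ, (∃ b ∈ B, b ≤ t) → ∑ n ∈ B, b n ≤ η := by
    intro d
    induction d with
    | zero =>
      intro t N η hη
      refine ⟨0, by simp [IsWeight], by simp, ?_, ?_, ?_⟩
      · refine mem_familyComp_of_coloring (isRegularFamily_card_le 0) id ?_ ?_ ?_ ?_ <;>
          simp [MonotoneOn]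
      · intro B _
        simp only [Finsupp.coe_zero, Pi.zero_apply, Finset.sum_const_zero]
        positivity
      · intro B _ _
        simp only [Finsupp.coe_zero, Pi.zero_apply, Finset.sum_const_zero]
        exact hη.le
    | succ d ihd =>
      intro t N η hη
      obtain ⟨a, ha1, haL, haS, haB⟩ := piece t N (η / 2) (by positivity)
      have hne := ha1.support_nonempty
      set u := a.support.max' hne with hu
      -- The later pieces are made small on every member of `S_ξ` that starts no later than `u`, the
      -- last point of the first piece. A member meeting the first piece thus collects at most its
      -- full weight `1` plus a small remainder.
      obtain ⟨b, hb1, hbL, hbS, hbB, hbB'⟩ := ihd (max t u) (max N (u + 1)) (η / 2) (by positivity)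
      have hsub : ∀ x ∈ a.support, ∀ y ∈ b.support, x < y := by
        intro x hx y hy
        exact (a.support.le_max' x hx).trans_lt
          ((PNat.lt_add_right u 1).trans_le ((le_max_right _ _).trans (hbL y hy).2))
      have hsupp : (a + b).support = a.support ∪ b.support := by
        refine Finsupp.support_add_eq (Finset.disjoint_left.2 fun x hx hy => ?_)
        exact lt_irrefl _ (hsub x hx x hy)
      refine ⟨a + b, ?_, ?_, ?_, ?_, ?_⟩
      · have := ha1.add hb1
        rwa [add_comm (1 : ℝ), ← Nat.cast_succ] at this
      · intro n hn
        rw [hsupp] at hn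
        rcases Finset.mem_union.1 hn with hn | hn
        · exact haL n hn
        · exact ⟨(hbL n hn).1, (le_max_left _ _).trans (hbL n hn).2⟩
      · rw [hsupp]
        exact union_mem_familyComp_card_le haS hne hbS hsub
      · intro B hB
        simp only [Finsupp.add_apply, Finset.sum_add_distrib]
        by_cases h : ∃ n ∈ B, n ∈ a.support
        · obtain ⟨n, hnB, hn⟩ := h
          have h1 := hbB' B hB ⟨n, hnB, (a.support.le_max' n hn).trans (le_max_right _ _)⟩
          have h2 := ha1.sum_le B
          linarith
        · push Not at h
          have h1 : ∑ n ∈ B, a n = 0 :=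
            Finset.sum_eq_zero fun n hn => Finsupp.notMem_support_iff.1 (h n hn)
          have h2 := hbB B hB
          linarith
      · rintro B hB ⟨n, hnB, hn⟩
        simp only [Finsupp.add_apply, Finset.sum_add_distrib]
        have h1 := haB B hB ⟨n, hnB, hn⟩
        have h2 := hbB' B hB ⟨n, hnB, hn.trans (le_max_left _ _)⟩
        linarith
  -- Before normalization each member of `S_ξ` has weight at most `1 + 1`, so dividing by `d > 2 /
  -- δ` suffices. Starting beyond `d` makes the `d` pieces `S_1`-admissible.
  obtain ⟨d, hd⟩ := exists_nat_gt (2 / δ)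
  have hd0 : (0 : ℝ) < d := (by positivity : (0 : ℝ) < 2 / δ).trans hd
  have hd0' : 0 < d := by exact_mod_cast hd0
  obtain ⟨b, hb1, hbL, hbS, hbB, -⟩ := pieces d 1 (max N ⟨d, hd0'⟩) 1 one_pos
  have hsupp : ((d : ℝ)⁻¹ • b).support = b.support :=
    Finsupp.support_smul_eq (inv_ne_zero hd0.ne')
  refine ⟨(d : ℝ)⁻¹ • b, ?_, ?_, ?_, ?_⟩
  · have := hb1.smul (inv_nonneg.2 hd0.le)
    rwa [inv_mul_cancel₀ hd0.ne'] at this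
  · rw [hsupp]
    exact fun n hn => ⟨(hbL n hn).1, (le_max_left _ _).trans (hbL n hn).2⟩
  · rw [hsupp, schreier_succ]
    obtain ⟨c, hc, hcB, hcF, hcG⟩ := exists_coloring_of_mem_familyComp hbS
    refine mem_familyComp_of_coloring isRegularFamily_schreierOne c hc (fun a ha => (hcB a ha).1)
      (fun m hm => hcF.trans ?_) hcG
    obtain ⟨a, ha, rfl⟩ := Finset.mem_image.1 hm
    exact PNat.coe_le_coe _ _ |>.2 ((le_max_right _ _).trans (hbL _ (hcB a ha).2).2)
  · intro B hB
    have h1 := hbB B hB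
    have h2 : ∑ n ∈ B, ((d : ℝ)⁻¹ • b) n = (d : ℝ)⁻¹ * ∑ n ∈ B, b n := by
      rw [Finset.mul_sum]
      rfl
    rw [h2, inv_mul_le_iff₀ hd0]
    rw [div_lt_iff₀ hδ] at hd
    linarith

end Schreier

/-! ### The norm of `T[F, 1/2]` on `c₀₀` -/

theorem coordRestrict_apply (E : Finset ℕ+) (x : ℕ+ →₀ ℝ) (n : ℕ+) :
    coordRestrict E x n = if n ∈ E then x n else 0 :=
  Finsupp.filter_apply _ _ _

theorem coordRestrict_of_subset {E : Finset ℕ+} {x : ℕ+ →₀ ℝ} (h : x.support ⊆ E) :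
    coordRestrict E x = x := by
  ext n
  rw [coordRestrict_apply]
  split_ifs with hn
  · rfl
  · exact (Finsupp.notMem_support_iff.1 fun h' => hn (h h')).symm

theorem coordRestrict_of_disjoint {E : Finset ℕ+} {x : ℕ+ →₀ ℝ} (h : ∀ n ∈ E, x n = 0) :
    coordRestrict E x = 0 := by
  ext n
  rw [coordRestrict_apply]
  split_ifs with hn
  · exact h n hn
  · rfl

theorem IsNorming.abs_le {F : Set (Finset ℕ+)} {f : (ℕ+ →₀ ℝ) →ₗ[ℝ] ℝ} (hf : IsNorming F f)
    (x : ℕ+ →₀ ℝ) : |f x| ≤ tsirelsonNorm F x :=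
  abs_le'.2 ⟨hf.le_tsirelsonNorm x, hf.neg'.le_tsirelsonNorm x⟩

theorem tsirelsonNorm_le {F : Set (Finset ℕ+)} {x : ℕ+ →₀ ℝ} {r : ℝ}
    (h : ∀ f, IsNorming F f → f x ≤ r) : tsirelsonNorm F x ≤ r :=
  ciSup_le fun f => h f.1 f.2

theorem tsirelsonNorm_zero (F : Set (Finset ℕ+)) : tsirelsonNorm F 0 = 0 := by
  simpa using tsirelsonNorm_smul F 0 0

/-- The norm is a lattice norm: the unit vectors form a `1`-unconditional basis. -/
theorem tsirelsonNorm_mono (F : Set (Finset ℕ+)) {x y : ℕ+ →₀ ℝ} (h : ∀ n, |x n| ≤ |y n|) :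
    tsirelsonNorm F x ≤ tsirelsonNorm F y := by
  have key : ∀ f, IsNorming F f → ∀ x y : ℕ+ →₀ ℝ, (∀ n, |x n| ≤ |y n|) →
      ∃ g, IsNorming F g ∧ f x ≤ g y := by
    intro f hf
    induction hf with
    | pos n =>
      intro x y h
      rcases abs_choice (y n) with hy | hy
      · exact ⟨_, .pos n, (le_abs_self _).trans ((h n).trans_eq hy)⟩
      · exact ⟨_, .neg n, (le_abs_self _).trans ((h n).trans_eq hy)⟩
    | neg n =>
      intro x y h
      rcases abs_choice (y n) with hy | hy
      · exact ⟨_, .pos n, (neg_le_abs _).trans ((h n).trans_eq hy)⟩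
      · exact ⟨_, .neg n, (neg_le_abs _).trans ((h n).trans_eq hy)⟩
    | half E f hE _ ih =>
      intro x y h
      have : ∀ i, ∃ g, IsNorming F g ∧ f i (coordRestrict (E i) x) ≤ g (coordRestrict (E i) y) := by
        intro i
        refine ih i _ _ fun n => ?_
        rw [coordRestrict_apply, coordRestrict_apply]
        split_ifs
        · exact h n
        · exact le_rfl
      choose g hg hle using this
      refine ⟨_, .half E g hE hg, ?_⟩
      simp only [LinearMap.smul_apply, LinearMap.sum_apply, LinearMap.comp_apply, smul_eq_mul]
      gcongr with i
      exact hle i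
  refine tsirelsonNorm_le fun f hf => ?_
  obtain ⟨g, hg, hle⟩ := key f hf x y h
  exact hle.trans (hg.le_tsirelsonNorm y)

theorem tsirelsonNorm_coordRestrict_le (F : Set (Finset ℕ+)) (E : Finset ℕ+) (x : ℕ+ →₀ ℝ) :
    tsirelsonNorm F (coordRestrict E x) ≤ tsirelsonNorm F x := by
  refine tsirelsonNorm_mono F fun n => ?_
  rw [coordRestrict_apply]
  split_ifs
  · exact le_rfl
  · rw [abs_zero]
    exact abs_nonneg _

theorem tsirelsonNorm_sum_le (F : Set (Finset ℕ+)) {ι : Type*} (s : Finset ι)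
    (x : ι → ℕ+ →₀ ℝ) : tsirelsonNorm F (∑ i ∈ s, x i) ≤ ∑ i ∈ s, tsirelsonNorm F (x i) :=
  Finset.le_sum_of_subadditive _ (tsirelsonNorm_zero F).le (tsirelsonNorm_add_le F) s x

/-- Admissible families indexed by a finite set. -/
theorem half_sum_tsirelsonNorm_le {F : Set (Finset ℕ+)} {ι : Type*} [LinearOrder ι]
    (s : Finset ι) (E : ι → Finset ℕ+) (m : ι → ℕ+)
    (hlt : ∀ i ∈ s, ∀ j ∈ s, i < j → ∀ a ∈ E i, ∀ b ∈ E j, a < b)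
    (hm : ∀ i ∈ s, IsLeast (E i : Set ℕ+) (m i)) (hF : s.image m ∈ F) (x : ℕ+ →₀ ℝ) :
    1 / 2 * ∑ i ∈ s, tsirelsonNorm F (coordRestrict (E i) x) ≤ tsirelsonNorm F x := by
  let e := s.orderEmbOfFin rfl
  have hes : ∀ i, e i ∈ s := s.orderEmbOfFin_mem rfl
  have himg : Finset.univ.image e = s := s.image_orderEmbOfFin_univ rfl
  refine (tsirelsonNorm_isLUB F x).1 (Or.inr ⟨s.card, fun i => E (e i), ⟨?_, fun i => m (e i),
    fun i => hm _ (hes i), ?_⟩, ?_⟩)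
  · exact fun i j hij => hlt _ (hes i) _ (hes j) (e.strictMono hij)
  · convert hF using 1
    conv_rhs => rw [← himg, Finset.image_image]
    rfl
  · conv_lhs => rw [← himg, Finset.sum_image fun i _ j _ h => e.injective h]

theorem tsirelsonNorm_le_sum (F : Set (Finset ℕ+)) (x : ℕ+ →₀ ℝ) :
    tsirelsonNorm F x ≤ ∑ n ∈ x.support, |x n| :=
  tsirelsonNorm_le fun _ hf => hf.le_sum x

/-- The singletons of `A` are themselves admissible; this `ℓ₁`-estimate is what prevents the
inclusion from being `S_ξ`-strictly singular. -/
theorem half_sum_abs_le {F : Set (Finset ℕ+)} {A : Finset ℕ+} (hA : A ∈ F) (x : ℕ+ →₀ ℝ) :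
    1 / 2 * ∑ n ∈ A, |x n| ≤ tsirelsonNorm F x := by
  refine le_trans ?_ (half_sum_tsirelsonNorm_le A (fun n => {n}) id ?_ ?_ (by simpa using hA) x)
  · gcongr with n
    refine le_trans (le_of_eq ?_) (abs_le_tsirelsonNorm F (coordRestrict {n} x) n)
    rw [coordRestrict_apply, if_pos (Finset.mem_singleton_self n)]
  · intro i _ j _ hij a ha b hb
    rw [Finset.mem_singleton.1 ha, Finset.mem_singleton.1 hb]
    exact hij
  · exact fun i _ => by simp

/-- On vectors supported in `[n, ∞)` only the members of the family inside `[n, ∞)` matter. -/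
theorem tsirelsonNorm_le_of_tail {F G : Set (Finset ℕ+)} (hG : IsRegularFamily G) {n : ℕ+}
    (hGF : ∀ A ∈ G, (∀ a ∈ A, n ≤ a) → A ∈ F) {x : ℕ+ →₀ ℝ} (hx : ∀ k ∈ x.support, n ≤ k) :
    tsirelsonNorm G x ≤ tsirelsonNorm F x := by
  classical
  have key : ∀ f, IsNorming G f → ∀ x : ℕ+ →₀ ℝ, (∀ k ∈ x.support, n ≤ k) →
      f x ≤ tsirelsonNorm F x := by
    intro f hf
    induction hf with
    | pos k => exact fun x _ => (le_abs_self _).trans (abs_le_tsirelsonNorm F x k)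
    | neg k => exact fun x _ => (neg_le_abs _).trans (abs_le_tsirelsonNorm F x k)
    | @half d E f hE _ ih =>
      intro x hx
      obtain ⟨hlt, m, hm, hmG⟩ := hE
      -- Cutting off the part below `n` does not affect `x`. It moves the minima to the right and
      -- may empty some sets, so the minima of the remaining ones form a spread of a subset of the
      -- old minima.
      let E' : Fin d → Finset ℕ+ := fun i => (E i).filter (n ≤ ·)
      let s : Finset (Fin d) := Finset.univ.filter fun i => (E' i).Nonempty
      have hres : ∀ i, coordRestrict (E i) x = coordRestrict (E' i) x := by
        intro i
        ext k
        rw [coordRestrict_apply, coordRestrict_apply]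
        by_cases hk : n ≤ k
        · simp [E', hk]
        · have : x k = 0 := Finsupp.notMem_support_iff.1 fun h => hk (hx k h)
          simp [this]
      have hex : ∀ i, ∃ k, i ∈ s → IsLeast (E' i : Set ℕ+) k := by
        intro i
        by_cases hi : (E' i).Nonempty
        · exact ⟨(E' i).min' hi, fun _ => (E' i).isLeast_min' hi⟩
        · exact ⟨1, fun h => absurd (Finset.mem_filter.1 h).2 hi⟩
      choose m' hm' using hex
      have hm'E : ∀ i ∈ s, m' i ∈ E i ∧ n ≤ m' i := fun i hi => Finset.mem_filter.1 (hm' i hi).1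
      have hlt' : ∀ i ∈ s, ∀ j ∈ s, i < j → m' i < m' j := fun i hi j hj hij =>
        hlt i j hij _ (hm'E i hi).1 _ (hm'E j hj).1
      have hinj : Set.InjOn m' (s : Set (Fin d)) :=
        StrictMonoOn.injOn fun i hi j hj hij => hlt' i hi j hj hij
      have hmono : ∀ i j, i < j → m i < m j := fun i j hij => hlt i j hij _ (hm i).1 _ (hm j).1
      have hF : s.image m' ∈ F := by
        refine hGF _ ?_ ?_
        · rcases s.eq_empty_or_nonempty with hs | ⟨i₀, hi₀⟩
          · rw [hs, Finset.image_empty]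
            exact hG.mono hmG (Finset.empty_subset _)
          have : Nonempty (Fin d) := ⟨i₀⟩
          have hinv : ∀ i ∈ s, Function.invFunOn m' (s : Set (Fin d)) (m' i) = i :=
            fun i hi => hinj.leftInvOn_invFunOn hi
          refine hG _ hmG _ (fun b => m (Function.invFunOn m' (s : Set (Fin d)) b)) ?_ ?_
          · intro b hb
            obtain ⟨i, hi, rfl⟩ := Finset.mem_image.1 hb
            simp only [hinv i hi]
            exact ⟨Finset.mem_image_of_mem _ (Finset.mem_univ _), (hm i).2 (hm'E i hi).1⟩
          · intro b hb b' hb' hbb'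
            obtain ⟨i, hi, rfl⟩ := Finset.mem_image.1 (Finset.mem_coe.1 hb)
            obtain ⟨j, hj, rfl⟩ := Finset.mem_image.1 (Finset.mem_coe.1 hb')
            simp only [hinv i hi, hinv j hj]
            refine hmono i j ?_
            by_contra hij
            rcases (not_lt.1 hij).eq_or_lt with rfl | hij
            · exact lt_irrefl _ hbb'
            · exact lt_asymm hbb' (hlt' j hj i hi hij)
        · intro b hb
          obtain ⟨i, hi, rfl⟩ := Finset.mem_image.1 hb
          exact (hm'E i hi).2
      refine le_trans ?_ (half_sum_tsirelsonNorm_le s E' m' ?_ hm' hF x)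
      · simp only [LinearMap.smul_apply, LinearMap.sum_apply, LinearMap.comp_apply, smul_eq_mul]
        have : ∑ i, f i (coordRestrict (E i) x) = ∑ i ∈ s, f i (coordRestrict (E i) x) := by
          refine (Finset.sum_subset (Finset.subset_univ _) fun i _ hi => ?_).symm
          have hi : E' i = ∅ := by
            rw [← Finset.not_nonempty_iff_eq_empty]
            exact fun h => hi (Finset.mem_filter.2 ⟨Finset.mem_univ _, h⟩)
          rw [hres, hi, coordRestrict_of_disjoint (by simp), map_zero]
        rw [this]
        gcongr with i
        rw [hres]
        refine ih i _ fun k hk => ?_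
        by_contra hnk
        rw [Finsupp.mem_support_iff, coordRestrict_apply] at hk
        exact hk (if_neg fun h => hnk (Finset.mem_filter.1 h).2)
      · intro i _ j _ hij a ha b hb
        exact hlt i j hij a (Finset.mem_filter.1 ha).1 b (Finset.mem_filter.1 hb).1
  exact tsirelsonNorm_le fun f hf => key f hf x hx

theorem tsirelsonNorm_single (F : Set (Finset ℕ+)) (n : ℕ+) (r : ℝ) :
    tsirelsonNorm F (Finsupp.single n r) = |r| := by
  refine le_antisymm ?_ ?_
  · refine (tsirelsonNorm_le_sum F _).trans ?_
    refine (Finset.sum_le_sum_of_subset_of_nonneg Finsupp.support_single_subset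
      fun _ _ _ => abs_nonneg _).trans ?_
    simp
  · simpa using abs_le_tsirelsonNorm F (Finsupp.single n r) n

/-- Each of the finitely many coordinates below `n` costs at most one sup-norm, and the tail is
compared with constant `1`. -/
theorem exists_tsirelsonNorm_le {F G : Set (Finset ℕ+)} (hG : IsRegularFamily G) {n : ℕ+}
    (hGF : ∀ A ∈ G, (∀ a ∈ A, n ≤ a) → A ∈ F) (x : ℕ+ →₀ ℝ) :
    tsirelsonNorm G x ≤ (n + 1) * tsirelsonNorm F x := by
  classical
  set y := coordRestrict (x.support.filter (n ≤ ·)) x with hy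
  have hsplit : x = ∑ k ∈ Finset.Iio n, Finsupp.single k (x k) + y := by
    ext k
    rw [Finsupp.add_apply, Finsupp.finsetSum_apply, hy, coordRestrict_apply]
    simp only [Finsupp.single_apply, Finset.sum_ite_eq', Finset.mem_Iio, Finset.mem_filter,
      Finsupp.mem_support_iff]
    by_cases hk : k < n
    · simp [hk, not_le.2 hk]
    · by_cases hx : x k = 0 <;> simp [hk, not_lt.1 hk, hx]
  have hcard : ((Finset.Iio n).card : ℝ) ≤ n := by
    have : (Finset.Iio n).card ≤ (n : ℕ) := by
      refine (Finset.card_le_card_of_injOn (fun k : ℕ+ => (k : ℕ)) (t := Finset.range n) ?_ ?_).trans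
        (Finset.card_range _).le
      · intro k hk
        exact Finset.mem_coe.2 (Finset.mem_range.2 (PNat.coe_lt_coe _ _ |>.2
          (Finset.mem_Iio.1 (Finset.mem_coe.1 hk))))
      · exact PNat.coe_injective.injOn
    exact_mod_cast this
  calc tsirelsonNorm G x
      = tsirelsonNorm G (∑ k ∈ Finset.Iio n, Finsupp.single k (x k) + y) := by rw [← hsplit]
    _ ≤ ∑ k ∈ Finset.Iio n, tsirelsonNorm G (Finsupp.single k (x k)) + tsirelsonNorm G y :=
        (tsirelsonNorm_add_le G _ _).trans (add_le_add (tsirelsonNorm_sum_le G _ _) le_rfl)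
    _ ≤ ∑ k ∈ Finset.Iio n, tsirelsonNorm F x + tsirelsonNorm F x := by
        gcongr with k
        · rw [tsirelsonNorm_single]
          exact abs_le_tsirelsonNorm F x k
        · refine (tsirelsonNorm_le_of_tail hG hGF fun k hk => ?_).trans
            (tsirelsonNorm_coordRestrict_le F _ x)
          by_contra hnk
          rw [Finsupp.mem_support_iff, hy, coordRestrict_apply] at hk
          exact hk (if_neg fun h => hnk (Finset.mem_filter.1 h).2)
    _ = ((Finset.Iio n).card + 1) * tsirelsonNorm F x := by
        rw [Finset.sum_const, nsmul_eq_mul]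
        ring
    _ ≤ (n + 1) * tsirelsonNorm F x := by
        have := tsirelsonNorm_nonneg F x
        gcongr

/-! ### Averages of block sequences -/

/-- The vectors `u l`, `l ∈ L`, are successive, and `u l` is supported in `[l, l')` where `l'` is
the element of `L` that follows `l`. -/
def IsBlockFamily (L : Set ℕ+) (u : ℕ+ → ℕ+ →₀ ℝ) : Prop :=
  ∀ l ∈ L, ∀ n ∈ (u l).support, l ≤ n ∧ ∀ l' ∈ L, l < l' → n < l'

theorem IsBlockFamily.mono {L L' : Set ℕ+} {u : ℕ+ → ℕ+ →₀ ℝ} (h : IsBlockFamily L u)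
    (hL : L' ⊆ L) : IsBlockFamily L' u :=
  fun l hl n hn => ⟨(h l (hL hl) n hn).1, fun l' hl' => (h l (hL hl) n hn).2 l' (hL hl')⟩

theorem IsBlockFamily.apply_eq_zero {L : Set ℕ+} {u : ℕ+ → ℕ+ →₀ ℝ} (h : IsBlockFamily L u)
    {l l' : ℕ+} (hl : l ∈ L) (hl' : l' ∈ L) (hne : l ≠ l') {n : ℕ+} (hn : n ∈ (u l).support) :
    u l' n = 0 := by
  by_contra h0
  have hn' := Finsupp.mem_support_iff.2 h0
  rcases lt_or_gt_of_ne hne with hlt | hlt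
  · exact absurd (((h l hl n hn).2 l' hl' hlt).trans_le (h l' hl' n hn').1) (lt_irrefl _)
  · exact absurd (((h l' hl' n hn').2 l hl hlt).trans_le (h l hl n hn).1) (lt_irrefl _)

/-- In `1/2 ∑ g i ∘ E i`, a block met by at most one `E i` contributes at most half of its norm
bound. Blocks met by two or more of these sets are few: apart from the first, their indices form a
member of `F`, so together they have weight at most `2δ`. -/
theorem tsirelsonNorm_average_le {F : Set (Finset ℕ+)} (hF : IsRegularFamily F) {c δ : ℝ}
    (hc : 0 ≤ c) {u : ℕ+ → ℕ+ →₀ ℝ} {a : ℕ+ →₀ ℝ} (ha : IsWeight 1 a)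
    (hu : IsBlockFamily a.support u) (huc : ∀ l ∈ a.support, tsirelsonNorm F (u l) ≤ c)
    (hδ : ∀ l, a l ≤ δ) (hδF : ∀ B ∈ F, ∑ n ∈ B, a n ≤ δ) :
    tsirelsonNorm F (∑ l ∈ a.support, a l • u l) ≤ c * (1 / 2 + 2 * δ) := by
  classical
  have hδ0 : 0 ≤ δ := (ha.1 1).trans (hδ 1)
  have hcoord : ∀ n, |(∑ l ∈ a.support, a l • u l) n| ≤ c * (1 / 2 + 2 * δ) := by
    intro n
    rw [Finsupp.finsetSum_apply]
    by_cases h : ∃ l ∈ a.support, n ∈ (u l).support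
    · obtain ⟨l, hl, hn⟩ := h
      rw [Finset.sum_eq_single_of_mem l hl]
      · rw [Finsupp.smul_apply, smul_eq_mul, abs_mul, abs_of_nonneg (ha.1 l)]
        calc a l * |u l n| ≤ δ * c := by
              gcongr
              · exact hδ l
              · exact (abs_le_tsirelsonNorm F _ n).trans (huc l hl)
          _ ≤ _ := by nlinarith [mul_nonneg hc hδ0]
      · intro l' hl' hne
        rw [Finsupp.smul_apply, hu.apply_eq_zero hl hl' hne.symm hn, smul_zero]
    · push Not at h
      rw [Finset.sum_eq_zero, abs_zero]
      · positivity
      · intro l hl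
        rw [Finsupp.smul_apply, Finsupp.notMem_support_iff.1 (h l hl), smul_zero]
  refine tsirelsonNorm_le fun f hf => ?_
  have hf' := hf
  cases hf with
  | pos n => exact (le_abs_self _).trans (hcoord n)
  | neg n => exact (neg_le_abs _).trans (hcoord n)
  | @half d E g hE hg =>
    obtain ⟨hlt, m, hm, hmF⟩ := hE
    set f : (ℕ+ →₀ ℝ) →ₗ[ℝ] ℝ := (1 / 2 : ℝ) • ∑ i, (g i) ∘ₗ coordRestrict (E i) with hfdef
    -- the blocks that meet at least two of the sets `E i`
    let S : Finset ℕ+ := a.support.filter fun l =>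
      ∃ i j, i < j ∧ (∃ n ∈ E i, n ∈ (u l).support) ∧ ∃ n ∈ E j, n ∈ (u l).support
    have hSsub : S ⊆ a.support := Finset.filter_subset _ _
    have hS : ∑ l ∈ S, a l ≤ 2 * δ := by
      rcases S.eq_empty_or_nonempty with h | hne
      · rw [h, Finset.sum_empty]
        positivity
      -- If a block meets `E i` and a later `E j`, then `min (E j)` lies after its index and before
      -- the next index of the support.
      have hbetween : ∀ l ∈ S, ∃ k ∈ Finset.univ.image m, l < k ∧
          ∀ l' ∈ a.support, l < l' → k < l' := by
        intro l hl
        obtain ⟨hla, i, j, hij, ⟨n, hnE, hn⟩, n', hnE', hn'⟩ := Finset.mem_filter.1 hl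
        refine ⟨m j, Finset.mem_image_of_mem _ (Finset.mem_univ _), ?_, fun l' hl' hll' => ?_⟩
        · exact (hu l hla n hn).1.trans_lt (hlt i j hij n hnE _ (hm j).1)
        · exact ((hm j).2 hnE').trans_lt ((hu l hla n' hn').2 l' hl' hll')
      set l₀ := S.min' hne with hl₀
      -- Each bad index is sent to the largest minimum below it. By `hbetween` this is strictly
      -- increasing, so spreading applies. The first bad index is removed because no minimum need
      -- precede it.
      have hex : ∀ b, ∃ k, b ∈ S.erase l₀ → k ∈ Finset.univ.image m ∧ k < b ∧
          ∀ k' ∈ Finset.univ.image m, k' < b → k' ≤ k := by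
        intro b
        by_cases hb : b ∈ S.erase l₀
        · obtain ⟨hne', hbS⟩ := Finset.mem_erase.1 hb
          have hl₀b : l₀ < b := lt_of_le_of_ne (S.min'_le b hbS) (Ne.symm hne')
          obtain ⟨k, hk, -, hkb⟩ := hbetween l₀ (S.min'_mem hne)
          have hne'' : ((Finset.univ.image m).filter (· < b)).Nonempty :=
            ⟨k, Finset.mem_filter.2 ⟨hk, hkb b (hSsub hbS) hl₀b⟩⟩
          refine ⟨_, fun _ => ⟨(Finset.mem_filter.1 (Finset.max'_mem _ hne'')).1,
            (Finset.mem_filter.1 (Finset.max'_mem _ hne'')).2, fun k' hk' hk'b => ?_⟩⟩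
          exact Finset.le_max' _ _ (Finset.mem_filter.2 ⟨hk', hk'b⟩)
        · exact ⟨1, fun h => absurd h hb⟩
      choose h hh using hex
      have hmem : S.erase l₀ ∈ F := by
        refine hF _ hmF _ h (fun b hb => ⟨(hh b hb).1, (hh b hb).2.1.le⟩) ?_
        intro b hb b' hb' hbb'
        obtain ⟨k, hk, hbk, hkb'⟩ := hbetween b (Finset.mem_of_mem_erase hb)
        exact ((hh b hb).2.1.trans hbk).trans_le ((hh b' hb').2.2 k hk
          (hkb' b' (hSsub (Finset.mem_of_mem_erase hb')) hbb'))
      rw [← Finset.add_sum_erase _ _ (S.min'_mem hne)]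
      linarith [hδ l₀, hδF _ hmem]
    have hgood : ∀ l ∈ a.support, l ∉ S → f (u l) ≤ c / 2 := by
      intro l hl hlS
      have hsingle : ∀ i j, i ≠ j → (∃ n ∈ E i, n ∈ (u l).support) →
          ¬ ∃ n ∈ E j, n ∈ (u l).support := by
        intro i j hne h h'
        rcases lt_or_gt_of_ne hne with hij | hij
        · exact hlS (Finset.mem_filter.2 ⟨hl, i, j, hij, h, h'⟩)
        · exact hlS (Finset.mem_filter.2 ⟨hl, j, i, hij, h', h⟩)
      have hzero : ∀ i, (¬ ∃ n ∈ E i, n ∈ (u l).support) → g i (coordRestrict (E i) (u l)) = 0 := by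
        intro i h
        rw [coordRestrict_of_disjoint, map_zero]
        intro n hn
        by_contra h0
        exact h ⟨n, hn, Finsupp.mem_support_iff.2 h0⟩
      have hval : f (u l) = 1 / 2 * ∑ i, g i (coordRestrict (E i) (u l)) := by
        simp [hfdef]
      rw [hval]
      have : ∑ i, g i (coordRestrict (E i) (u l)) ≤ c := by
        by_cases h : ∃ i, ∃ n ∈ E i, n ∈ (u l).support
        · obtain ⟨i, hi⟩ := h
          rw [Finset.sum_eq_single_of_mem i (Finset.mem_univ _)
            fun j _ hj => hzero j (hsingle i j hj.symm hi)]
          exact ((hg i).le_tsirelsonNorm _).trans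
            ((tsirelsonNorm_coordRestrict_le F _ _).trans (huc l hl))
        · push Not at h
          rw [Finset.sum_eq_zero fun i _ => hzero i (by push Not; exact h i)]
          exact hc
      linarith
    have hbad : ∀ l ∈ a.support, f (u l) ≤ c := fun l hl =>
      (hf'.le_tsirelsonNorm _).trans (huc l hl)
    rw [map_sum, ← Finset.sum_sdiff hSsub]
    simp only [map_smul, smul_eq_mul]
    have h1 : ∑ l ∈ a.support \ S, a l * f (u l) ≤ c / 2 := by
      calc ∑ l ∈ a.support \ S, a l * f (u l) ≤ ∑ l ∈ a.support \ S, a l * (c / 2) := by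
            refine Finset.sum_le_sum fun l hl => ?_
            obtain ⟨hl, hlS⟩ := Finset.mem_sdiff.1 hl
            exact mul_le_mul_of_nonneg_left (hgood l hl hlS) (ha.1 l)
        _ = (∑ l ∈ a.support \ S, a l) * (c / 2) := by rw [Finset.sum_mul]
        _ ≤ 1 * (c / 2) := by
            gcongr
            exact ha.sum_le _
        _ = c / 2 := one_mul _
    have h2 : ∑ l ∈ S, a l * f (u l) ≤ 2 * δ * c := by
      calc ∑ l ∈ S, a l * f (u l) ≤ ∑ l ∈ S, a l * c :=
            Finset.sum_le_sum fun l hl => mul_le_mul_of_nonneg_left (hbad l (hSsub hl)) (ha.1 l)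
        _ = (∑ l ∈ S, a l) * c := by rw [Finset.sum_mul]
        _ ≤ 2 * δ * c := by gcongr
    linarith

/-- Every map on `ℕ+` is dominated by the gaps of an infinite set. -/
theorem exists_infinite_lacunary (h : ℕ+ → ℕ+) :
    ∃ L : Set ℕ+, L.Infinite ∧ ∀ l ∈ L, ∀ l' ∈ L, l < l' → h l < l' := by
  obtain ⟨φ, hφ, hle⟩ := exists_strictMono_ge h
  let s : ℕ → ℕ+ := fun k => (fun n => φ n + 1)^[k] 1
  have hs : ∀ k, s (k + 1) = φ (s k) + 1 := fun k => Function.iterate_succ_apply' _ _ _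
  have hmono : StrictMono s := by
    refine strictMono_nat_of_lt_succ fun k => ?_
    rw [hs]
    exact hφ.le_apply.trans_lt (PNat.lt_add_right _ _)
  refine ⟨Set.range s, Set.infinite_range_of_injective hmono.injective, ?_⟩
  rintro _ ⟨i, rfl⟩ _ ⟨j, rfl⟩ hij
  have hij : i + 1 ≤ j := hmono.lt_iff_lt.1 hij
  calc h (s i) ≤ φ (s i) := hle _
    _ < s (i + 1) := by rw [hs]; exact PNat.lt_add_right _ _
    _ ≤ s j := hmono.monotone hij

theorem IsWeight.sum_smul {b : ℕ+ →₀ ℝ} {t : ℝ} (hb : IsWeight t b) {a : ℕ+ → ℕ+ →₀ ℝ}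
    (ha : ∀ i ∈ b.support, IsWeight 1 (a i)) : IsWeight t (∑ i ∈ b.support, b i • a i) := by
  classical
  have key : ∀ s ⊆ b.support, IsWeight (∑ i ∈ s, b i) (∑ i ∈ s, b i • a i) := by
    intro s
    induction s using Finset.induction_on with
    | empty => simp [IsWeight]
    | insert i s hi ih =>
      intro hs
      rw [Finset.sum_insert hi, Finset.sum_insert hi]
      have h := (ha i (hs (Finset.mem_insert_self i s))).smul (hb.1 i)
      rw [mul_one] at h
      exact h.add (ih ((Finset.subset_insert i s).trans hs))
  have := key _ subset_rfl
  rwa [hb.2] at this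

theorem IsRegularFamily.iterFamily {F : Set (Finset ℕ+)} (hF : IsRegularFamily F) :
    ∀ m, IsRegularFamily (iterFamily F m)
  | 0 => isRegularFamily_card_le 1
  | m + 1 => hF.familyComp (hF.iterFamily m)

/-- Iterated special convex combinations of a block sequence have small norm in
`T[S_ξ, 1/2]`. -/
theorem exists_iterated_average {ladder : Ordinal.{0} → ℕ+ → Ordinal.{0}}
    (hl : IsLadderSystem ladder) {ξ : Ordinal.{0}} (hξ : ξ < ω₁) {L : Set ℕ+} (hL : L.Infinite)
    {y : ℕ+ → ℕ+ →₀ ℝ} (hy : IsBlockFamily L y) {c : ℝ} (hc : 0 ≤ c)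
    (hyc : ∀ l ∈ L, tsirelsonNorm (schreier ladder ξ) (y l) ≤ c) (m : ℕ) :
    ∀ N : ℕ+, ∃ a : ℕ+ →₀ ℝ, IsWeight 1 a ∧ (∀ n ∈ a.support, n ∈ L ∧ N ≤ n) ∧
      a.support ∈ iterFamily (schreier ladder (ξ + 1)) m ∧
      tsirelsonNorm (schreier ladder ξ) (∑ l ∈ a.support, a l • y l) ≤ c * (3 / 4) ^ m := by
  classical
  have hreg := isRegularFamily_schreier hl ξ hξ
  have hreg' := isRegularFamily_schreier hl _ (add_one_lt_omega_one hξ)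
  induction m with
  | zero =>
    intro N
    obtain ⟨n, hnL, hn⟩ := hL.exists_gt N
    have hsupp : (Finsupp.single n (1 : ℝ)).support = {n} :=
      Finsupp.support_single _ one_ne_zero
    refine ⟨Finsupp.single n 1, ⟨fun k => ?_, ?_⟩, ?_, ?_, ?_⟩
    · rw [Finsupp.single_apply]
      split_ifs <;> norm_num
    · rw [hsupp, Finset.sum_singleton, Finsupp.single_eq_same]
    · rw [hsupp]
      intro k hk
      rw [Finset.mem_singleton.1 hk]
      exact ⟨hnL, hn.le⟩
    · rw [hsupp]
      simp [iterFamily, schreierZero]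
    · rw [hsupp, Finset.sum_singleton, Finsupp.single_eq_same, one_smul, pow_zero, mul_one]
      exact hyc n hnL
  | succ m ih =>
    intro N
    choose a ha haL haF hac using ih
    let u : ℕ+ → ℕ+ →₀ ℝ := fun k => ∑ l ∈ (a k).support, a k l • y l
    have hu : ∀ k, u k = Finsupp.linearCombination ℝ y (a k) := fun k => rfl
    have hmax : ∀ k, ∃ h : ℕ+, (∀ n ∈ (a k).support, n ≤ h) ∧ ∀ n ∈ (u k).support, n ≤ h := by
      intro k
      obtain ⟨h, hh⟩ := ((a k).support ∪ (u k).support).bddAbove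
      exact ⟨h, fun n hn => hh (Finset.mem_coe.2 (Finset.mem_union_left _ hn)),
        fun n hn => hh (Finset.mem_coe.2 (Finset.mem_union_right _ hn))⟩
    choose h hha hhu using hmax
    -- Outer indices are taken so far apart that both the vectors `u k` and the supports of the `a
    -- k` are successive.
    obtain ⟨L', hL', hlac⟩ := exists_infinite_lacunary h
    obtain ⟨b, hb, hbL, hbS, hbB⟩ :=
      -- The value `1/8` gives the factor `1/2 + 2 * (1/8) = 3/4`.
      exists_special_convex_combination hl hL' ξ hξ N (1 / 8) (by norm_num)
    have hublock : IsBlockFamily b.support u := by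
      intro k hk n hn
      refine ⟨?_, fun k' hk' hkk' => (hhu k n hn).trans_lt
        (hlac k (hbL k hk).1 k' (hbL k' hk').1 hkk')⟩
      by_contra hlt
      refine Finsupp.mem_support_iff.1 hn ?_
      simp only [u, Finsupp.finsetSum_apply]
      refine Finset.sum_eq_zero fun l hl => ?_
      have : y l n = 0 := by
        by_contra h0
        exact hlt ((haL k l hl).2.trans (hy l (haL k l hl).1 n (Finsupp.mem_support_iff.2 h0)).1)
      rw [Finsupp.smul_apply, this, smul_zero]
    set a' : ℕ+ →₀ ℝ := ∑ k ∈ b.support, b k • a k with ha'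
    -- The outer index of a point of the support serves as its colour; it is at most the point since
    -- `a k` lives in `[k, ∞)`.
    have hmem : ∀ l, ∃ k, l ∈ a'.support → k ∈ b.support ∧ l ∈ (a k).support := by
      intro l
      by_contra! hcon
      have hla : l ∈ a'.support := (hcon 1).1
      refine Finsupp.mem_support_iff.1 hla ?_
      rw [ha', Finsupp.finsetSum_apply]
      refine Finset.sum_eq_zero fun k hk => ?_
      rw [Finsupp.smul_apply, Finsupp.notMem_support_iff.1 ((hcon k).2 hk), smul_zero]
    choose κ hκ using hmem
    refine ⟨a', hb.sum_smul fun k _ => ha k, ?_, ?_, ?_⟩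
    · intro l hl
      obtain ⟨h1, h2⟩ := hκ l hl
      exact ⟨(haL _ l h2).1, (hbL _ h1).2.trans (haL _ l h2).2⟩
    · refine mem_familyComp_of_coloring hreg' κ ?_ ?_ ?_ ?_
      · intro l hl l' hl' hll'
        obtain ⟨h1, h2⟩ := hκ l hl
        obtain ⟨h1', h2'⟩ := hκ l' hl'
        by_contra hlt
        have := hlac _ (hbL _ h1').1 _ (hbL _ h1).1 (not_le.1 hlt)
        exact absurd (((hha _ l' h2').trans_lt this).trans_le (haL _ l h2).2) (not_lt.2 hll')
      · exact fun l hl => (haL _ l (hκ l hl).2).2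
      · refine hreg'.mono hbS fun k hk => ?_
        obtain ⟨l, hl, rfl⟩ := Finset.mem_image.1 hk
        exact (hκ l hl).1
      · intro k hk
        refine (hreg'.iterFamily m).mono (haF k) fun l hl => ?_
        obtain ⟨hl, rfl⟩ := Finset.mem_filter.1 hl
        exact (hκ l ‹_›).2
    · have hsum : ∑ l ∈ a'.support, a' l • y l = ∑ k ∈ b.support, b k • u k := by
        change Finsupp.linearCombination ℝ y a' = _
        simp only [ha', map_sum, map_smul, hu]
      rw [hsum]
      have hsing : ∀ l, b l ≤ 1 / 8 := by
        intro l
        have := hbB {l} (schreierZero_subset hl ξ hξ (by simp [schreierZero]))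
        rwa [Finset.sum_singleton] at this
      refine (tsirelsonNorm_average_le hreg (by positivity) hb hublock (fun k _ => hac k) hsing
        hbB).trans_eq ?_
      rw [pow_succ]
      ring

/-! ### The completion -/

/-- `tsirelsonOf` as a linear map. -/
noncomputable def tsirelsonOfLinear (F : Set (Finset ℕ+)) : (ℕ+ →₀ ℝ) →ₗ[ℝ] Tsirelson F where
  toFun := tsirelsonOf F
  map_add' x y := UniformSpace.Completion.coe_add (α := TsirelsonC00 F) x y
  map_smul' c x := UniformSpace.Completion.coe_smul (M := ℝ) (X := TsirelsonC00 F) c x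

theorem tsirelsonOfLinear_apply (F : Set (Finset ℕ+)) (x : ℕ+ →₀ ℝ) :
    tsirelsonOfLinear F x = tsirelsonOf F x := rfl

theorem denseRange_tsirelsonOf (F : Set (Finset ℕ+)) : DenseRange (tsirelsonOf F) :=
  UniformSpace.Completion.denseRange_coe (α := TsirelsonC00 F)

theorem exists_tsirelson_extension (F : Set (Finset ℕ+)) {V : Type*} [NormedAddCommGroup V]
    [NormedSpace ℝ V] [CompleteSpace V] (T : (ℕ+ →₀ ℝ) →ₗ[ℝ] V) (C : ℝ)
    (h : ∀ x, ‖T x‖ ≤ C * tsirelsonNorm F x) :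
    ∃ S : Tsirelson F →L[ℝ] V, (∀ x, S (tsirelsonOf F x) = T x) ∧ ∀ z, ‖S z‖ ≤ C * ‖z‖ := by
  let T' : TsirelsonC00 F →L[ℝ] V := LinearMap.mkContinuous
    { toFun := fun x => T x, map_add' := T.map_add, map_smul' := T.map_smul } C h
  let e : TsirelsonC00 F →L[ℝ] Tsirelson F := UniformSpace.Completion.toComplL
  have hS : ∀ x, T'.extend e (tsirelsonOf F x) = T x := fun x =>
    T'.extend_eq (e := e) UniformSpace.Completion.denseRange_coe
      (UniformSpace.Completion.isUniformInducing_coe _) x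
  refine ⟨T'.extend e, hS, fun z => ?_⟩
  refine (denseRange_tsirelsonOf F).induction_on (p := fun z => ‖T'.extend e z‖ ≤ C * ‖z‖) z
    (isClosed_le (by fun_prop) (by fun_prop)) fun x => ?_
  rw [hS, norm_tsirelsonOf]
  exact h x

theorem exists_tsirelsonCoord (F : Set (Finset ℕ+)) (n : ℕ+) :
    ∃ S : Tsirelson F →L[ℝ] ℝ, (∀ x, S (tsirelsonOf F x) = x n) ∧ ∀ z, ‖S z‖ ≤ 1 * ‖z‖ :=
  exists_tsirelson_extension F (Finsupp.lapply n) 1 fun x => by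
    rw [one_mul]; exact abs_le_tsirelsonNorm F x n

/-- The coordinate functionals of `T[F, 1/2]`. -/
noncomputable def tsirelsonCoord (F : Set (Finset ℕ+)) (n : ℕ+) : Tsirelson F →L[ℝ] ℝ :=
  (exists_tsirelsonCoord F n).choose

theorem tsirelsonCoord_of (F : Set (Finset ℕ+)) (n : ℕ+) (x : ℕ+ →₀ ℝ) :
    tsirelsonCoord F n (tsirelsonOf F x) = x n :=
  (exists_tsirelsonCoord F n).choose_spec.1 x

/-- The unit vectors of `T[F, 1/2]`. -/
noncomputable def tsirelsonUnit (F : Set (Finset ℕ+)) (n : ℕ+) : Tsirelson F :=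
  tsirelsonOf F (Finsupp.single n 1)

theorem tsirelsonCoord_unit (F : Set (Finset ℕ+)) (n k : ℕ+) :
    tsirelsonCoord F n (tsirelsonUnit F k) = if n = k then 1 else 0 := by
  rw [tsirelsonUnit, tsirelsonCoord_of, Finsupp.single_apply]
  simp only [eq_comm]

/-- The basis projection onto the coordinates in `E`. -/
noncomputable def tsirelsonProj (F : Set (Finset ℕ+)) (E : Finset ℕ+) (z : Tsirelson F) :
    Tsirelson F := ∑ n ∈ E, tsirelsonCoord F n z • tsirelsonUnit F n

theorem continuous_tsirelsonProj (F : Set (Finset ℕ+)) (E : Finset ℕ+) :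
    Continuous (tsirelsonProj F E) := by
  unfold tsirelsonProj
  fun_prop

theorem tsirelsonProj_sub (F : Set (Finset ℕ+)) (E : Finset ℕ+) (z w : Tsirelson F) :
    tsirelsonProj F E (z - w) = tsirelsonProj F E z - tsirelsonProj F E w := by
  simp only [tsirelsonProj, map_sub, sub_smul, Finset.sum_sub_distrib]

theorem tsirelsonProj_of (F : Set (Finset ℕ+)) (E : Finset ℕ+) (x : ℕ+ →₀ ℝ) :
    tsirelsonProj F E (tsirelsonOf F x) = tsirelsonOf F (coordRestrict E x) := by
  have h : coordRestrict E x = ∑ n ∈ E, x n • Finsupp.single n (1 : ℝ) := by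
    ext k
    rw [coordRestrict_apply, Finsupp.finsetSum_apply]
    simp [Finsupp.single_apply]
  rw [h, ← tsirelsonOfLinear_apply F (∑ n ∈ E, _), map_sum]
  simp only [tsirelsonProj, tsirelsonCoord_of, map_smul]
  rfl

theorem norm_tsirelsonProj_le (F : Set (Finset ℕ+)) (E : Finset ℕ+) (z : Tsirelson F) :
    ‖tsirelsonProj F E z‖ ≤ ‖z‖ := by
  refine (denseRange_tsirelsonOf F).induction_on (p := fun z => ‖tsirelsonProj F E z‖ ≤ ‖z‖) z
    (isClosed_le (continuous_tsirelsonProj F E).norm continuous_norm) fun x => ?_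
  rw [tsirelsonProj_of, norm_tsirelsonOf, norm_tsirelsonOf]
  exact tsirelsonNorm_coordRestrict_le F E x

theorem tendsto_tsirelson_expansion (F : Set (Finset ℕ+)) (z : Tsirelson F) :
    Tendsto (fun k => ∑ i ∈ Finset.range k,
      tsirelsonCoord F i.succPNat z • tsirelsonUnit F i.succPNat) atTop (𝓝 z) := by
  classical
  have hP : ∀ k, ∑ i ∈ Finset.range k, tsirelsonCoord F i.succPNat z • tsirelsonUnit F i.succPNat =
      tsirelsonProj F ((Finset.range k).image Nat.succPNat) z := by
    intro k
    rw [tsirelsonProj, Finset.sum_image fun i _ j _ h => Nat.succPNat_injective h]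
  simp only [hP]
  rw [Metric.tendsto_atTop]
  intro ε hε
  obtain ⟨x, hx⟩ := (denseRange_tsirelsonOf F).exists_dist_lt z (half_pos hε)
  obtain ⟨N, hN⟩ := (x.support.image fun n : ℕ+ => (n : ℕ)).bddAbove
  refine ⟨N, fun k hk => ?_⟩
  set E := (Finset.range k).image Nat.succPNat with hE
  have hxE : tsirelsonProj F E (tsirelsonOf F x) = tsirelsonOf F x := by
    rw [tsirelsonProj_of, coordRestrict_of_subset]
    intro n hn
    have h1 : (n : ℕ) ≤ N := hN (Finset.mem_coe.2 (Finset.mem_image_of_mem _ hn))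
    have h2 := n.pos
    refine Finset.mem_image.2 ⟨n.natPred, Finset.mem_range.2 ?_, PNat.succPNat_natPred n⟩
    have := PNat.natPred_add_one n
    omega
  rw [dist_eq_norm] at hx ⊢
  have h1 := norm_tsirelsonProj_le F E (z - tsirelsonOf F x)
  rw [tsirelsonProj_sub, hxE] at h1
  calc ‖tsirelsonProj F E z - z‖
      = ‖(tsirelsonProj F E z - tsirelsonOf F x) - (z - tsirelsonOf F x)‖ := by
        congr 1; abel
    _ ≤ ‖tsirelsonProj F E z - tsirelsonOf F x‖ + ‖z - tsirelsonOf F x‖ := norm_sub_le _ _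
    _ < ε := by linarith

theorem eq_zero_of_tsirelsonCoord {F : Set (Finset ℕ+)} {z : Tsirelson F}
    (h : ∀ n, tsirelsonCoord F n z = 0) : z = 0 := by
  have := tendsto_tsirelson_expansion F z
  simp only [h, zero_smul, Finset.sum_const_zero] at this
  exact (tendsto_nhds_unique this tendsto_const_nhds)

/-- The formal inclusion between two spaces with comparable norms. -/
theorem exists_formal_inclusion {F G : Set (Finset ℕ+)} {C : ℝ}
    (h : ∀ x, tsirelsonNorm G x ≤ C * tsirelsonNorm F x) :
    ∃ i : Tsirelson F →L[ℝ] Tsirelson G, (∀ x, i (tsirelsonOf F x) = tsirelsonOf G x) ∧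
      Function.Injective i := by
  obtain ⟨i, hi, -⟩ := exists_tsirelson_extension F (tsirelsonOfLinear G) C fun x => by
    rw [tsirelsonOfLinear_apply, norm_tsirelsonOf]; exact h x
  refine ⟨i, hi, (injective_iff_map_eq_zero i).2 fun z hz => eq_zero_of_tsirelsonCoord fun n => ?_⟩
  have : tsirelsonCoord F n z = tsirelsonCoord G n (i z) := by
    refine (denseRange_tsirelsonOf F).induction_on
      (p := fun z => tsirelsonCoord F n z = tsirelsonCoord G n (i z)) z
      (isClosed_eq (by fun_prop) (by fun_prop)) fun x => ?_
    rw [hi, tsirelsonOfLinear_apply, tsirelsonCoord_of, tsirelsonCoord_of]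
  rw [this, hz, map_zero]

/-! ### Basic sequences -/

section Basic

variable {V : Type*} [NormedAddCommGroup V] [NormedSpace ℝ V]

theorem isBasicSequence_of_biorthogonal {x : ℕ+ → V} (g : ℕ → V →L[ℝ] ℝ)
    (hg : ∀ i j : ℕ, g i (x j.succPNat) = if i = j then 1 else 0)
    (hx : ∀ z ∈ (Submodule.span ℝ (Set.range x)).topologicalClosure,
      Tendsto (fun k => ∑ i ∈ Finset.range k, g i z • x i.succPNat) atTop (𝓝 z)) :
    IsBasicSequence x := by
  let W := (Submodule.span ℝ (Set.range x)).topologicalClosure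
  have hmem : ∀ n, x n ∈ W := fun n =>
    Submodule.le_topologicalClosure _ (Submodule.subset_span ⟨n, rfl⟩)
  refine ⟨⟨fun i => ⟨x i.succPNat, hmem _⟩, fun i => (g i).comp W.subtypeL, ?_, ?_⟩, fun _ => rfl⟩
  · intro i j
    rw [ContinuousLinearMap.comp_apply, Submodule.subtypeL_apply, hg]
    by_cases h : i = j
    · subst h
      simp
    · simp [Pi.single, Function.update, h]
  · intro z
    rw [HasSum, SummationFilter.conditional_filter_eq_map_range, tendsto_map'_iff,
      tendsto_subtype_rng]
    convert hx z z.2 using 2 with k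
    simp

/-- Hahn–Banach extends the coordinate functionals to the whole space, so that passing to other
subspaces needs no coercions between closed spans. -/
theorem IsBasicSequence.exists_biorthogonal {x : ℕ+ → V} (h : IsBasicSequence x) :
    ∃ g : ℕ → V →L[ℝ] ℝ, (∀ i j : ℕ, g i (x j.succPNat) = if i = j then 1 else 0) ∧
      ∀ z ∈ (Submodule.span ℝ (Set.range x)).topologicalClosure,
        Tendsto (fun k => ∑ i ∈ Finset.range k, g i z • x i.succPNat) atTop (𝓝 z) := by
  obtain ⟨b, hb⟩ := h
  choose g hg using fun i => exists_extension_norm_eq _ (b.coord i)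
  refine ⟨g, fun i j => ?_, fun z hz => ?_⟩
  · rw [← hb j, (hg i).1, b.ortho]
    by_cases h : i = j
    · subst h
      simp
    · simp [Pi.single, Function.update, h]
  · have := (continuous_subtype_val.tendsto _).comp (SchauderBasis.tendsto_proj b ⟨z, hz⟩)
    convert this using 2 with k
    simp only [Function.comp_apply, SchauderBasis.proj_apply, Submodule.coe_sum,
      Submodule.coe_smul, hb]
    exact Finset.sum_congr rfl fun i _ => by rw [← (hg i).1]

theorem IsBasicSequence.linearIndependent {x : ℕ+ → V} (h : IsBasicSequence x) :
    LinearIndependent ℝ x := by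
  obtain ⟨g, hg, -⟩ := h.exists_biorthogonal
  rw [linearIndependent_iff]
  intro l hl
  ext n
  have := congrArg (g n.natPred) hl
  rw [Finsupp.linearCombination_apply, Finsupp.sum, map_sum, map_zero] at this
  have h1 : ∀ k : ℕ+, g n.natPred (x k) = if n = k then 1 else 0 := by
    intro k
    have := hg n.natPred k.natPred
    rw [PNat.succPNat_natPred] at this
    rw [this]
    simp only [PNat.natPred_inj]
  simpa [h1] using this

/-- The first `N` functionals vanish on the closed span of the tail, so the full expansion there has
no initial terms. -/
theorem IsBasicSequence.shift {x : ℕ+ → V} (h : IsBasicSequence x) (N : ℕ) :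
    IsBasicSequence fun n : ℕ+ => x (n.natPred + N).succPNat := by
  obtain ⟨g, hg, hx⟩ := h.exists_biorthogonal
  refine isBasicSequence_of_biorthogonal (fun i => g (i + N)) (fun i j => ?_) fun z hz => ?_
  · rw [Nat.natPred_succPNat, hg]
    simp
  · have hsub : Submodule.span ℝ (Set.range fun n : ℕ+ => x (n.natPred + N).succPNat) ≤
        Submodule.span ℝ (Set.range x) :=
      Submodule.span_mono (by rintro _ ⟨n, rfl⟩; exact ⟨_, rfl⟩)
    have hzero : ∀ i < N, g i z = 0 := by
      intro i hi
      have hle : (Submodule.span ℝ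
          (Set.range fun n : ℕ+ => x (n.natPred + N).succPNat)).topologicalClosure ≤
          (g i).toLinearMap.ker := by
        refine Submodule.topologicalClosure_minimal _ ?_ (g i).isClosed_ker
        rw [Submodule.span_le]
        rintro _ ⟨n, rfl⟩
        change g i _ = 0
        rw [hg, if_neg (by omega)]
      exact hle hz
    have h1 := (tendsto_add_atTop_iff_nat N).2 (hx z (Submodule.topologicalClosure_mono hsub hz))
    convert h1 using 2 with k
    have h0 : ∑ i ∈ Finset.range N, g i z • x i.succPNat = 0 :=
      Finset.sum_eq_zero fun i hi => by rw [hzero i (Finset.mem_range.1 hi), zero_smul]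
    rw [add_comm k N, Finset.sum_range_add, h0, zero_add]
    refine Finset.sum_congr rfl fun i _ => ?_
    rw [Nat.natPred_succPNat, add_comm]

end Basic

theorem isBasicSequence_tsirelsonUnit (F : Set (Finset ℕ+)) :
    IsBasicSequence (tsirelsonUnit F) := by
  refine isBasicSequence_of_biorthogonal (fun i => tsirelsonCoord F i.succPNat) (fun i j => ?_)
    fun z _ => tendsto_tsirelson_expansion F z
  rw [tsirelsonCoord_unit]
  simp only [Nat.succPNat_inj]

theorem isBasicSequence_tsirelsonUnit_prod (F : Set (Finset ℕ+)) (Y : Type*)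
    [NormedAddCommGroup Y] [NormedSpace ℝ Y] :
    IsBasicSequence fun n => (tsirelsonUnit F n, (0 : Y)) := by
  refine isBasicSequence_of_biorthogonal
    (fun i => (tsirelsonCoord F i.succPNat).comp (ContinuousLinearMap.fst ℝ _ _)) (fun i j => ?_)
    fun z hz => ?_
  · simp only [ContinuousLinearMap.comp_apply, ContinuousLinearMap.coe_fst', tsirelsonCoord_unit,
      Nat.succPNat_inj]
  · have hle : (Submodule.span ℝ
        (Set.range fun n => (tsirelsonUnit F n, (0 : Y)))).topologicalClosure ≤
        (ContinuousLinearMap.snd ℝ (Tsirelson F) Y).toLinearMap.ker := by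
      refine Submodule.topologicalClosure_minimal _ ?_ (ContinuousLinearMap.isClosed_ker _)
      rw [Submodule.span_le]
      rintro _ ⟨n, rfl⟩
      rfl
    have hz2 : z.2 = 0 := hle hz
    have h1 := (tendsto_tsirelson_expansion F z.1).prodMk_nhds (tendsto_const_nhds (x := (0 : Y)))
    have hz' : z = (z.1, 0) := Prod.ext rfl hz2
    rw [← hz'] at h1
    convert h1 using 2 with k
    refine Prod.ext ?_ ?_
    · simp [Prod.fst_sum]
    · simp [Prod.snd_sum]

/-! ### The formal inclusion -/

/-- Dimension count: fewer linear conditions than independent vectors. It replaces a passage to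
block subsequences and keeps control of which indices are used. -/
theorem exists_mem_span_coord_eq_zero {F : Set (Finset ℕ+)} {Z : Type*} [NormedAddCommGroup Z]
    [NormedSpace ℝ Z] (π : Z →L[ℝ] Tsirelson F) {v : ℕ+ → Z} (hv : LinearIndependent ℝ v)
    {D E : Finset ℕ+} (hED : E.card < D.card) :
    ∃ w ∈ Submodule.span ℝ (v '' (D : Set ℕ+)), w ≠ 0 ∧
      ∀ j ∈ E, tsirelsonCoord F j (π w) = 0 := by
  classical
  let W := Submodule.span ℝ (v '' (D : Set ℕ+))
  have hfin : Module.finrank ℝ W = D.card := by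
    have h1 : W = Submodule.span ℝ (Set.range (v ∘ ((↑) : D → ℕ+))) := by
      rw [show W = Submodule.span ℝ (v '' (D : Set ℕ+)) from rfl, Set.image_eq_range]
      rfl
    rw [h1, finrank_span_eq_card (hv.comp _ Subtype.val_injective), Fintype.card_coe]
  have : FiniteDimensional ℝ W := FiniteDimensional.span_of_finite ℝ (D.finite_toSet.image v)
  let f : W →ₗ[ℝ] (E → ℝ) :=
    LinearMap.pi fun j => ((tsirelsonCoord F j).comp π).toLinearMap ∘ₗ W.subtype
  have hker : f.ker ≠ ⊥ := by
    refine LinearMap.ker_ne_bot_of_finrank_lt ?_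
    rw [hfin, Module.finrank_fintype_fun_eq_card, Fintype.card_coe]
    exact hED
  obtain ⟨w, hw, hw0⟩ := Submodule.exists_mem_ne_zero_of_ne_bot hker
  refine ⟨w, w.2, fun h => hw0 (Subtype.ext h), fun j hj => ?_⟩
  exact congrFun (LinearMap.mem_ker.1 hw) ⟨j, hj⟩

/-- Deleting the coordinates in `E` from a finitely supported approximant costs no more than the
approximation error, because the projection is a contraction and annihilates `z`. -/
theorem exists_block_approximation {F : Set (Finset ℕ+)} {E : Finset ℕ+} {z : Tsirelson F}
    (hz : ∀ j ∈ E, tsirelsonCoord F j z = 0) {δ : ℝ} (hδ : 0 < δ) :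
    ∃ y : ℕ+ →₀ ℝ, (∀ n ∈ y.support, n ∉ E) ∧ ‖z - tsirelsonOf F y‖ ≤ δ := by
  obtain ⟨x, hx⟩ := (denseRange_tsirelsonOf F).exists_dist_lt z (half_pos hδ)
  rw [dist_eq_norm] at hx
  refine ⟨x - coordRestrict E x, fun n hn hnE => ?_, ?_⟩
  · refine Finsupp.mem_support_iff.1 hn ?_
    rw [Finsupp.sub_apply, coordRestrict_apply, if_pos hnE, sub_self]
  · have h0 : tsirelsonProj F E z = 0 :=
      Finset.sum_eq_zero fun j hj => by rw [hz j hj, zero_smul]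
    have h1 := norm_tsirelsonProj_le F E (z - tsirelsonOf F x)
    rw [tsirelsonProj_sub, h0, zero_sub, norm_neg, tsirelsonProj_of] at h1
    have h2 : tsirelsonOf F (x - coordRestrict E x) =
        tsirelsonOf F x - tsirelsonOf F (coordRestrict E x) :=
      map_sub (tsirelsonOfLinear F) _ _
    rw [h2, ← sub_add]
    exact (norm_add_le _ _).trans (by linarith)

/-- The lower `ℓ₁`-estimate for admissible averages. -/
theorem half_le_tsirelsonNorm_average {F : Set (Finset ℕ+)} {c : ℝ} (hc : 0 < c)
    {u : ℕ+ → ℕ+ →₀ ℝ} {a : ℕ+ →₀ ℝ} (ha : IsWeight 1 a) (hu : IsBlockFamily a.support u)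
    (huc : ∀ l ∈ a.support, c ≤ tsirelsonNorm F (u l))
    (hF : ∀ p : ℕ+ → ℕ+, (∀ l ∈ a.support, p l ∈ (u l).support) →
      StrictMonoOn p (a.support : Set ℕ+) → a.support.image p ∈ F) :
    c / 2 ≤ tsirelsonNorm F (∑ l ∈ a.support, a l • u l) := by
  classical
  have hne : ∀ l ∈ a.support, (u l).support.Nonempty := by
    intro l hl
    rw [Finsupp.support_nonempty_iff]
    intro h
    have := huc l hl
    rw [h, tsirelsonNorm_zero] at this
    linarith
  have hex : ∀ l, ∃ p, l ∈ a.support → IsLeast ((u l).support : Set ℕ+) p := by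
    intro l
    by_cases hl : l ∈ a.support
    · exact ⟨_, fun _ => (u l).support.isLeast_min' (hne l hl)⟩
    · exact ⟨1, fun h => absurd h hl⟩
  choose p hp using hex
  have hlt : ∀ i ∈ a.support, ∀ j ∈ a.support, i < j →
      ∀ n ∈ (u i).support, ∀ k ∈ (u j).support, n < k := fun i hi j hj hij n hn k hk =>
    ((hu i hi n hn).2 j hj hij).trans_le (hu j hj k hk).1
  refine le_trans ?_ (half_sum_tsirelsonNorm_le a.support (fun l => (u l).support) p hlt hp
    (hF p (fun l hl => (hp l hl).1) fun i hi j hj hij =>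
      hlt i hi j hj hij _ (hp i hi).1 _ (hp j hj).1) _)
  have hres : ∀ l ∈ a.support, coordRestrict (u l).support (∑ k ∈ a.support, a k • u k) =
      a l • u l := by
    intro l hl
    ext n
    rw [coordRestrict_apply]
    split_ifs with hn
    · rw [Finsupp.finsetSum_apply, Finset.sum_eq_single_of_mem l hl]
      intro k hk hkl
      rw [Finsupp.smul_apply, hu.apply_eq_zero hl hk hkl.symm hn, smul_zero]
    · rw [Finsupp.smul_apply, Finsupp.notMem_support_iff.1 hn, smul_zero]
  calc c / 2 = 1 / 2 * ∑ l ∈ a.support, a l * c := by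
        rw [← Finset.sum_mul, ha.2]
        ring
    _ ≤ _ := by
        gcongr with l hl
        rw [hres l hl, tsirelsonNorm_smul, abs_of_nonneg (ha.1 l)]
        exact mul_le_mul_of_nonneg_left (huc l hl) (ha.1 l)

/-! ### Strict singularity of the formal inclusion and comparison of the classes. -/

section Schreier

variable {ladder : Ordinal.{0} → ℕ+ → Ordinal.{0}}

/-- Since `1 ≤ ξ`, the left side is at most `ξ * (1 + 2m)`. The summand `1` accounts for the
`S_1`-sets of indices spent on each block. -/
theorem one_add_mul_lt_mul_omega {ξ : Ordinal.{0}} (hξ : 1 ≤ ξ) (m : ℕ) :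
    1 + (ξ + 1) * m < ξ * ω := by
  have h1 : (ξ + 1) * m ≤ ξ * ((1 + 1) * m : ℕ) := by
    rw [Ordinal.natCast_mul, ← mul_assoc]
    gcongr
    calc ξ + 1 ≤ ξ + ξ := by gcongr
      _ = ξ * ((1 + 1 : ℕ) : Ordinal.{0}) := by rw [Nat.cast_add, Nat.cast_one, mul_add, mul_one]
  calc 1 + (ξ + 1) * m ≤ ξ + ξ * ((1 + 1) * m : ℕ) := by gcongr
    _ = ξ * (1 + (1 + 1) * m : ℕ) := by rw [Nat.cast_add, mul_add, Nat.cast_one, mul_one]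
    _ < ξ * ω := mul_lt_mul_of_pos_left (Ordinal.natCast_lt_omega0 _) (zero_lt_one.trans_le hξ)

/-- The formal inclusion composed with any operator `π` is `S_{ξω}`-strictly singular. -/
theorem exists_norm_formal_inclusion_le (hl : IsLadderSystem ladder) {ξ : Ordinal.{0}}
    (hξ : 1 ≤ ξ) (hξ' : ξ < ω₁)
    {F G : Set (Finset ℕ+)} (hF : F = schreier ladder (ξ * ω)) (hG : G = schreier ladder ξ)
    {i : Tsirelson F →L[ℝ] Tsirelson G}
    (hi : ∀ x : ℕ+ →₀ ℝ, i (tsirelsonOf F x) = tsirelsonOf G x)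
    {Z : Type*} [NormedAddCommGroup Z] [NormedSpace ℝ Z] (π : Z →L[ℝ] Tsirelson F) {z : ℕ+ → Z} (hz : LinearIndependent ℝ z)
    {ε : ℝ} (hε : 0 < ε) :
    ∃ A ∈ F, ∃ w ∈ Submodule.span ℝ (z '' (A : Set ℕ+)), w ≠ 0 ∧ ‖i (π w)‖ ≤ ε * ‖w‖ := by
  classical
  by_contra! hcon
  -- ordinals and families
  have hω : ω < ω₁ := Ordinal.omega0_lt_omega_one
  have hξω : ξ * ω < ω₁ := mul_lt_omega_one hξ' hω
  have hξ1 : ξ + 1 < ω₁ := add_one_lt_omega_one hξ'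
  have h1ω : (1 : Ordinal.{0}) < ω₁ := Ordinal.one_lt_omega0.trans hω
  -- constants
  set K := ‖i‖ with hK
  have hK0 : 0 ≤ K := norm_nonneg _
  set P := ‖π‖ + 1 with hP
  have hP0 : 0 < P := by positivity
  -- The bound `1/8` keeps `(1 - δ) / 2 - δ` above `1/4`; the other one makes the perturbation
  -- negligible after applying `i`.
  set δ := min (1 / 8) (ε / (16 * P * (K + 1))) with hδ
  have hδ0 : 0 < δ := lt_min (by norm_num) (by positivity)
  have hδ8 : δ ≤ 1 / 8 := min_le_left _ _
  have hδK : K * δ ≤ ε / (16 * P) := by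
    calc K * δ ≤ (K + 1) * (ε / (16 * P * (K + 1))) := by
          gcongr
          · linarith
          · exact min_le_right _ _
      _ = ε / (16 * P) := by field_simp
  obtain ⟨m, hm⟩ := exists_pow_lt_of_lt_one (show (0 : ℝ) < ε / (16 * P * (2 * (K + 1))) by
    positivity) (show (3 / 4 : ℝ) < 1 by norm_num)
  have hmK : K * 2 * (3 / 4) ^ m ≤ ε / (16 * P) := by
    calc K * 2 * (3 / 4) ^ m ≤ (K + 1) * 2 * (ε / (16 * P * (2 * (K + 1)))) := by
          gcongr
          linarith
      _ = ε / (16 * P) := by field_simp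
  -- the spreading maps
  have hηω := one_add_mul_lt_mul_omega hξ m
  set η := (ξ + 1) * m with hη
  have hηlt : η < ω₁ := (le_add_self.trans_lt hηω).trans hξω
  have hregη := isRegularFamily_schreier hl η hηlt
  obtain ⟨φ, hφ, hφA⟩ := exists_image_iterFamily hl hξ1 m
  obtain ⟨ψ, hψ, hψA⟩ := exists_image_familyComp_schreier hl h1ω η hηlt
  obtain ⟨t₁, ht₁⟩ := schreier_subset_of_le hl (ξ * ω) hξω (le_add_self.trans hηω.le)
  obtain ⟨t₂, ht₂⟩ := schreier_subset_of_le hl (ξ * ω) hξω hηω.le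
  obtain ⟨t₃, ht₃⟩ := schreier_subset_of_le hl (ξ * ω) hξω (le_self_add.trans hηω.le)
  rw [← hF] at ht₁ ht₂ ht₃
  -- Indices of `z` are spread by `ψ` and moved beyond the thresholds needed to enter `F`.
  let σ : ℕ+ → ℕ+ := fun n => ψ n + t₂ + t₃
  have hσ : StrictMono σ := fun a b hab => by
    have := hψ hab
    simp only [σ]
    gcongr
  -- The first `q l` coordinates are to be annihilated, so the minima of the blocks exceed both `φ
  -- l` and `t₁`. The set `D l` has one index more than that, and starts late enough to lie in
  -- `S_1`.
  let q : ℕ+ → ℕ+ := fun l => φ l + t₁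
  let D : ℕ+ → Finset ℕ+ := fun l => Finset.Icc (φ l + q l) (φ l + q l + q l)
  have hDcard : ∀ l, (D l).card = q l + 1 := by
    intro l
    simp only [D, PNat.card_Icc, PNat.add_coe]
    omega
  have hDmin : ∀ l, ∀ n ∈ D l, φ l ≤ n := fun l n hn =>
    (PNat.lt_add_right _ _).le.trans (Finset.mem_Icc.1 hn).1
  have hD1 : ∀ l, D l ∈ schreierOne := by
    intro l n hn
    have h1 := (Finset.mem_Icc.1 hn).1
    rw [← PNat.coe_le_coe, PNat.add_coe] at h1
    have h2 := (φ l).pos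
    rw [hDcard]
    omega
  -- the vectors
  have hvec : ∀ l, ∃ w ∈ Submodule.span ℝ ((z ∘ σ) '' (D l : Set ℕ+)), ‖π w‖ = 1 ∧
      ∀ j ∈ Finset.Icc 1 (q l), tsirelsonCoord F j (π w) = 0 := by
    intro l
    have hcard : (Finset.Icc 1 (q l)).card < (D l).card := by
      rw [hDcard, PNat.card_Icc, PNat.one_coe]
      omega
    obtain ⟨w, hw, hw0, hwc⟩ :=
      exists_mem_span_coord_eq_zero π (hz.comp σ hσ.injective) hcard
    have hA : (D l).image σ ∈ F := by
      refine ht₃ _ ?_ ?_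
      · rw [schreier_one]
        refine isRegularFamily_schreierOne.image_of_le (φ := id) (by simpa using hD1 l)
          (strictMono_id.strictMonoOn _) (hσ.strictMonoOn _) fun n _ => hσ.le_apply
      · intro n hn
        obtain ⟨k, -, rfl⟩ := Finset.mem_image.1 hn
        exact (PNat.lt_add_left t₃ _).le
    -- The assumed failure of the conclusion, applied to `D l` alone, shows `π w ≠ 0`, so `w` can be
    -- normalized.
    have hbig := hcon _ hA w (by rwa [Finset.coe_image, ← Set.image_comp]) hw0
    have hπ : ‖π w‖ ≠ 0 := by
      intro h
      rw [norm_eq_zero.1 h, map_zero, norm_zero] at hbig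
      have := mul_nonneg hε.le (norm_nonneg w)
      linarith
    refine ⟨‖π w‖⁻¹ • w, Submodule.smul_mem _ _ hw, ?_, fun j hj => ?_⟩
    · rw [map_smul, norm_smul, norm_inv, norm_norm, inv_mul_cancel₀ hπ]
    · rw [map_smul, map_smul, hwc j hj, smul_zero]
  choose w hwspan hw1 hwc using hvec
  choose y hyE hyw using fun l => exists_block_approximation (hwc l) hδ0
  have hyq : ∀ l, ∀ n ∈ (y l).support, q l < n := by
    intro l n hn
    by_contra h
    exact hyE l n hn (Finset.mem_Icc.2 ⟨one_le, not_lt.1 h⟩)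
  have hynorm : ∀ l, 1 - δ ≤ tsirelsonNorm F (y l) ∧ tsirelsonNorm F (y l) ≤ 1 + δ := by
    intro l
    have h1 := abs_le.1 ((abs_norm_sub_norm_le _ _).trans (hyw l))
    rw [hw1, norm_tsirelsonOf] at h1
    constructor <;> linarith [h1.1, h1.2]
  have hnormG : ∀ x, tsirelsonNorm G x ≤ K * tsirelsonNorm F x := by
    intro x
    rw [← norm_tsirelsonOf, ← norm_tsirelsonOf, ← hi]
    exact i.le_opNorm _
  have hmax : ∀ l, ∃ h : ℕ+, (∀ n ∈ D l, n ≤ h) ∧ ∀ n ∈ (y l).support, n ≤ h := by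
    intro l
    obtain ⟨h, hh⟩ := (D l ∪ (y l).support).bddAbove
    exact ⟨h, fun n hn => hh (Finset.mem_coe.2 (Finset.mem_union_left _ hn)),
      fun n hn => hh (Finset.mem_coe.2 (Finset.mem_union_right _ hn))⟩
  choose h hhD hhy using hmax
  obtain ⟨L, hL, hlac⟩ := exists_infinite_lacunary h
  have hblock : IsBlockFamily L y := by
    intro l hl n hn
    refine ⟨?_, fun l' hl' hll' => (hhy l n hn).trans_lt (hlac l hl l' hl' hll')⟩
    exact hφ.le_apply.trans ((PNat.lt_add_right _ _).trans (hyq l n hn)).le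
  obtain ⟨a, ha, haL, haF, hanorm⟩ := exists_iterated_average hl hξ' hL hblock
    (c := K * 2) (by positivity) (fun l _ => by
      rw [← hG]
      refine (hnormG _).trans ?_
      gcongr
      linarith [(hynorm l).2]) m 1
  rw [← hG] at hanorm
  set x := ∑ l ∈ a.support, a l • y l with hx
  set W := ∑ l ∈ a.support, a l • w l with hW
  -- the lower estimate
  have hlow : (1 - δ) / 2 ≤ tsirelsonNorm F x := by
    refine half_le_tsirelsonNorm_average (by linarith) ha (hblock.mono fun l hl => (haL l hl).1)
      (fun l _ => (hynorm l).1) fun p hp hpm => ?_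
    refine ht₁ _ ?_ ?_
    · exact hregη.image_of_le (hφA _ haF) (hφ.strictMonoOn _) hpm fun l hl =>
        ((PNat.lt_add_right _ _).trans (hyq l _ (hp l hl))).le
    · intro n hn
      obtain ⟨l, hl, rfl⟩ := Finset.mem_image.1 hn
      exact ((PNat.lt_add_left t₁ _).trans (hyq l _ (hp l hl))).le
  -- the perturbation
  have hpert : ‖π W - tsirelsonOf F x‖ ≤ δ := by
    have h1 : π W - tsirelsonOf F x =
        ∑ l ∈ a.support, a l • (π (w l) - tsirelsonOf F (y l)) := by
      rw [hW, hx, ← tsirelsonOfLinear_apply F (∑ l ∈ a.support, _), map_sum, map_sum,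
        ← Finset.sum_sub_distrib]
      simp only [map_smul, smul_sub, tsirelsonOfLinear_apply]
    rw [h1]
    calc _ ≤ ∑ l ∈ a.support, ‖a l • (π (w l) - tsirelsonOf F (y l))‖ := norm_sum_le _ _
      _ ≤ ∑ l ∈ a.support, a l * δ := by
          refine Finset.sum_le_sum fun l _ => ?_
          rw [norm_smul, Real.norm_of_nonneg (ha.1 l)]
          exact mul_le_mul_of_nonneg_left (hyw l) (ha.1 l)
      _ = δ := by rw [← Finset.sum_mul, ha.2, one_mul]
  have hπW : 1 / 4 ≤ ‖π W‖ := by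
    have h1 := abs_le.1 ((abs_norm_sub_norm_le _ _).trans hpert)
    rw [norm_tsirelsonOf] at h1
    linarith [h1.1]
  have hPW : ‖π W‖ ≤ P * ‖W‖ := (π.le_opNorm W).trans (by
    gcongr
    simp [hP])
  have hW0 : W ≠ 0 := by
    intro h0
    rw [h0, map_zero, norm_zero] at hπW
    norm_num at hπW
  -- the set of indices
  have hmem : (a.support.biUnion D).image σ ∈ F := by
    have hcol : ∀ n, ∃ k, n ∈ a.support.biUnion D → k ∈ a.support ∧ n ∈ D k := by
      intro n
      by_cases hn : n ∈ a.support.biUnion D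
      · obtain ⟨k, hk, hnk⟩ := Finset.mem_biUnion.1 hn
        exact ⟨k, fun _ => ⟨hk, hnk⟩⟩
      · exact ⟨1, fun h => absurd h hn⟩
    choose κ hκ using hcol
    have hcomp : a.support.biUnion D ∈ familyComp (schreier ladder η) (schreier ladder 1) := by
      -- The colour of an index in `D l` is `φ l`, which lies below `D l`; the colours are in the
      -- spread support of `a`, and each class lies in one `D l`.
      refine mem_familyComp_of_coloring hregη (fun n => φ (κ n)) ?_ ?_ ?_ ?_
      · intro n hn n' hn' hnn'
        obtain ⟨h1, h2⟩ := hκ n hn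
        obtain ⟨h1', h2'⟩ := hκ n' hn'
        refine hφ.monotone ?_
        by_contra hlt
        have h3 := hlac _ (haL _ h1').1 _ (haL _ h1).1 (not_le.1 hlt)
        have h4 : κ n ≤ n := hφ.le_apply.trans (hDmin _ _ h2)
        exact absurd (((hhD _ _ h2').trans_lt h3).trans_le h4) (not_lt.2 hnn')
      · exact fun n hn => hDmin _ _ (hκ n hn).2
      · refine hregη.mono (hφA _ haF) fun k hk => ?_
        obtain ⟨n, hn, rfl⟩ := Finset.mem_image.1 hk
        exact Finset.mem_image_of_mem _ (hκ n hn).1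
      · intro k hk
        obtain ⟨n, hn, rfl⟩ := Finset.mem_image.1 hk
        rw [schreier_one]
        refine isRegularFamily_schreierOne.mono (hD1 (κ n)) fun n' hn' => ?_
        obtain ⟨hn', he⟩ := Finset.mem_filter.1 hn'
        rw [← hφ.injective he]
        exact (hκ n' hn').2
    refine ht₂ _ ?_ ?_
    · exact (isRegularFamily_schreier hl _ (hηω.trans hξω)).image_of_le (hψA _ hcomp)
        (hψ.strictMonoOn _) (hσ.strictMonoOn _) fun n _ =>
          ((PNat.lt_add_right _ _).trans (PNat.lt_add_right _ _)).le
    · intro n hn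
      obtain ⟨k, -, rfl⟩ := Finset.mem_image.1 hn
      exact ((PNat.lt_add_left t₂ _).trans (PNat.lt_add_right _ _)).le
  have hWspan : W ∈ Submodule.span ℝ (z '' (((a.support.biUnion D).image σ : Finset ℕ+) :
      Set ℕ+)) := by
    refine Submodule.sum_mem _ fun l hl => Submodule.smul_mem _ _ ?_
    refine Submodule.span_mono ?_ (hwspan l)
    rintro _ ⟨n, hn, rfl⟩
    exact ⟨σ n, Finset.mem_coe.2 (Finset.mem_image_of_mem _ (Finset.mem_biUnion.2 ⟨l, hl, hn⟩)),
      rfl⟩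
  have hbig := hcon _ hmem W hWspan hW0
  have hup : ‖i (π W)‖ ≤ ε / (16 * P) + ε / (16 * P) := by
    have h1 : i (π W) = i (π W - tsirelsonOf F x) + tsirelsonOf G x := by
      rw [map_sub, hi, sub_add_cancel]
    rw [h1]
    refine (norm_add_le _ _).trans (add_le_add ?_ ?_)
    · exact ((i.le_opNorm _).trans (mul_le_mul_of_nonneg_left hpert hK0)).trans hδK
    · rw [norm_tsirelsonOf]
      exact hanorm.trans hmK
  -- From `1/4 ≤ ‖π W‖ ≤ P * ‖W‖`; the upper bound is only `ε / (8 * P)`.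
  have h2 : ε / (4 * P) ≤ ε * ‖W‖ := by
    rw [div_le_iff₀ (by positivity)]
    nlinarith
  have h3 : ε / (16 * P) + ε / (16 * P) < ε / (4 * P) := by
    rw [← add_div, div_lt_div_iff₀ (by positivity) (by positivity)]
    nlinarith [mul_pos hε hP0]
  linarith

/-- The inclusion `S_α ⊆ S_β` is available only beyond some `n`, so the hypothesis is applied to the
sequence shifted by `n`; the indices then move right, which spreading allows. -/
theorem schreierSS_subset (hl : IsLadderSystem ladder) {α β : Ordinal.{0}} (hαβ : α ≤ β)
    (hβ : β < ω₁) (X Y : Type*) [NormedAddCommGroup X] [NormedSpace ℝ X] [NormedAddCommGroup Y]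
    [NormedSpace ℝ Y] : schreierSS ladder α X Y ⊆ schreierSS ladder β X Y := by
  classical
  intro T hT ε hε x hx
  obtain ⟨n, hn⟩ := schreier_subset_of_le hl β hβ hαβ
  obtain ⟨A, hA, z, hz, hz0, hTz⟩ := hT ε hε _ (hx.shift n)
  let s : ℕ+ → ℕ+ := fun k => (k.natPred + n).succPNat
  have hs : StrictMono s := by
    intro k k' hkk'
    refine Nat.succPNat_lt_succPNat.2 ?_
    have := PNat.natPred_lt_natPred.2 hkk'
    omega
  refine ⟨A.image s, hn _ ?_ ?_, z, ?_, hz0, hTz⟩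
  · exact (isRegularFamily_schreier hl α (hαβ.trans_lt hβ)).image_of_le (φ := id)
      (by simpa using hA) (strictMono_id.strictMonoOn _) (hs.strictMonoOn _) fun _ _ => hs.le_apply
  · intro k hk
    obtain ⟨j, -, rfl⟩ := Finset.mem_image.1 hk
    rw [← PNat.coe_le_coe, Nat.succPNat_coe]
    omega
  · rwa [Finset.coe_image, ← Set.image_comp]

theorem exists_of_mem_span_tsirelsonUnit {F : Set (Finset ℕ+)} {A : Finset ℕ+} {z : Tsirelson F}
    (hz : z ∈ Submodule.span ℝ (tsirelsonUnit F '' (A : Set ℕ+))) :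
    ∃ x : ℕ+ →₀ ℝ, x.support ⊆ A ∧ z = tsirelsonOf F x := by
  have h1 : tsirelsonUnit F '' (A : Set ℕ+) =
      tsirelsonOfLinear F '' ((fun n => Finsupp.single n (1 : ℝ)) '' (A : Set ℕ+)) := by
    rw [Set.image_image]
    rfl
  rw [h1, ← Submodule.map_span, ← Finsupp.supported_eq_span_single] at hz
  obtain ⟨x, hx, rfl⟩ := hz
  exact ⟨x, Finset.coe_subset.1 ((Finsupp.mem_supported _ _).1 hx), rfl⟩

/-- The `ℓ₁`-norm lies between: its half bounds the target norm from below, and it bounds the source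
norm from above. -/
theorem half_norm_le_formal_inclusion {F G : Set (Finset ℕ+)} {i : Tsirelson F →L[ℝ] Tsirelson G}
    (hi : ∀ x : ℕ+ →₀ ℝ, i (tsirelsonOf F x) = tsirelsonOf G x) {A : Finset ℕ+} (hA : A ∈ G)
    {z : Tsirelson F} (hz : z ∈ Submodule.span ℝ (tsirelsonUnit F '' (A : Set ℕ+))) :
    1 / 2 * ‖z‖ ≤ ‖i z‖ := by
  obtain ⟨x, hx, rfl⟩ := exists_of_mem_span_tsirelsonUnit hz
  rw [hi, norm_tsirelsonOf, norm_tsirelsonOf]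
  refine le_trans ?_ (half_sum_abs_le hA x)
  gcongr
  exact (tsirelsonNorm_le_sum F x).trans
    (Finset.sum_le_sum_of_subset_of_nonneg hx fun _ _ _ => abs_nonneg _)

end Schreier

theorem mainTheorem12 (ladder : Ordinal.{0} → ℕ+ → Ordinal.{0}) (hladder : IsLadderSystem ladder)
    (ξ : Ordinal.{0}) (hξ : 1 ≤ ξ) (hξ' : ξ < ω₁) :
    (∃ i : Tsirelson (schreier ladder (ξ * ω)) →L[ℝ] Tsirelson (schreier ladder ξ),
      (∀ x : ℕ+ →₀ ℝ, i (tsirelsonOf (schreier ladder (ξ * ω)) x) =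
        tsirelsonOf (schreier ladder ξ) x) ∧
      Function.Injective i ∧
      i ∈ schreierSS ladder (ξ * ω)
        (Tsirelson (schreier ladder (ξ * ω))) (Tsirelson (schreier ladder ξ)) ∧
      i ∉ schreierSS ladder ξ
        (Tsirelson (schreier ladder (ξ * ω))) (Tsirelson (schreier ladder ξ))) ∧
    schreierSS ladder ξ
        (Tsirelson (schreier ladder (ξ * ω))) (Tsirelson (schreier ladder ξ)) ⊂
      schreierSS ladder (ξ * ω)
        (Tsirelson (schreier ladder (ξ * ω))) (Tsirelson (schreier ladder ξ)) ∧
    schreierSS ladder ξ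
        (Tsirelson (schreier ladder (ξ * ω)) × Tsirelson (schreier ladder ξ))
        (Tsirelson (schreier ladder (ξ * ω)) × Tsirelson (schreier ladder ξ)) ⊂
      schreierSS ladder (ξ * ω)
        (Tsirelson (schreier ladder (ξ * ω)) × Tsirelson (schreier ladder ξ))
        (Tsirelson (schreier ladder (ξ * ω)) × Tsirelson (schreier ladder ξ)) := by
  have hξω : ξ * ω < ω₁ := mul_lt_omega_one hξ' Ordinal.omega0_lt_omega_one
  have hle : ξ ≤ ξ * ω := Ordinal.le_mul_left ξ Ordinal.omega0_pos
  obtain ⟨n, hn⟩ := schreier_subset_of_le hladder (ξ * ω) hξω hle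
  obtain ⟨i, hi, hinj⟩ := exists_formal_inclusion
    (exists_tsirelsonNorm_le (isRegularFamily_schreier hladder ξ hξ') hn)
  have hmem : i ∈ schreierSS ladder (ξ * ω)
      (Tsirelson (schreier ladder (ξ * ω))) (Tsirelson (schreier ladder ξ)) := fun ε hε x hx =>
    exists_norm_formal_inclusion_le hladder hξ hξ' rfl rfl hi (ContinuousLinearMap.id ℝ _)
      hx.linearIndependent hε
  have hnot : i ∉ schreierSS ladder ξ
      (Tsirelson (schreier ladder (ξ * ω))) (Tsirelson (schreier ladder ξ)) := by
    intro h
    obtain ⟨A, hA, z, hz, hz0, hTz⟩ :=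
      h (1 / 4) (by norm_num) _ (isBasicSequence_tsirelsonUnit _)
    have h1 := half_norm_le_formal_inclusion hi hA hz
    have h2 := norm_pos_iff.2 hz0
    linarith
  refine ⟨⟨i, hi, hinj, hmem, hnot⟩,
    (schreierSS_subset hladder hle hξω _ _).ssubset_of_not_subset fun h => hnot (h hmem),
    (schreierSS_subset hladder hle hξω _ _).ssubset_of_not_subset fun h => ?_⟩
  -- The inclusion as an off-diagonal corner of an operator on `Z`. Its singularity uses the key
  -- lemma with `π` the first projection, since a basic sequence of `Z` need not project to a basic
  -- sequence of `X`.
  let T := (ContinuousLinearMap.inr ℝ (Tsirelson (schreier ladder (ξ * ω)))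
    (Tsirelson (schreier ladder ξ))).comp (i.comp
      (ContinuousLinearMap.fst ℝ (Tsirelson (schreier ladder (ξ * ω)))
        (Tsirelson (schreier ladder ξ))))
  have hTnorm : ∀ z, ‖T z‖ = ‖i z.1‖ := fun z => by simp [T, Prod.norm_def]
  have hT : T ∈ schreierSS ladder (ξ * ω)
      (Tsirelson (schreier ladder (ξ * ω)) × Tsirelson (schreier ladder ξ))
      (Tsirelson (schreier ladder (ξ * ω)) × Tsirelson (schreier ladder ξ)) := by
    intro ε hε x hx
    obtain ⟨A, hA, z, hz, hz0, hTz⟩ := exists_norm_formal_inclusion_le hladder hξ hξ' rfl rfl hi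
      (ContinuousLinearMap.fst ℝ _ (Tsirelson (schreier ladder ξ))) hx.linearIndependent hε
    exact ⟨A, hA, z, hz, hz0, (hTnorm z).trans_le hTz⟩
  obtain ⟨A, hA, z, hz, hz0, hTz⟩ := h hT (1 / 4) (by norm_num) _
    (isBasicSequence_tsirelsonUnit_prod _ _)
  have hspan : (fun n => (tsirelsonUnit (schreier ladder (ξ * ω)) n,
      (0 : Tsirelson (schreier ladder ξ)))) '' (A : Set ℕ+) =
      LinearMap.inl ℝ (Tsirelson (schreier ladder (ξ * ω))) (Tsirelson (schreier ladder ξ)) ''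
         (tsirelsonUnit (schreier ladder (ξ * ω)) '' (A : Set ℕ+)) := by
    rw [Set.image_image]
    rfl
  rw [hspan, ← Submodule.map_span] at hz
  obtain ⟨z, hz, rfl⟩ := hz
  have h1 := half_norm_le_formal_inclusion hi hA hz
  have h2 : 0 < ‖z‖ := norm_pos_iff.2 fun h0 => hz0 (by rw [h0, map_zero])
  have h3 : ‖LinearMap.inl ℝ (Tsirelson (schreier ladder (ξ * ω)))
      (Tsirelson (schreier ladder ξ)) z‖ = ‖z‖ := by simp [Prod.norm_def]
  rw [hTnorm, h3, LinearMap.inl_apply] at hTz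
  linarith
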